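/- Let $\mathbb D\subset\mathbb C$ be a simply connected domain with coordinate $z=x+iy$, let $\pi:S^5\to\mathbb CP^2$ be the Hopf fibration ($\mathbb CP^2$ carries the Fubini–Study metric of holomorphic sectional curvature $4$), and write $X\cdot Y=\sum_k X_kY_k$ on $\mathbb C^3$. For a smooth map $\mathfrak f:\mathbb D\to S^5$ put $\xi=\mathfrak f_z-(\mathfrak f_z\cdot\bar{\mathfrak f})\mathfrak f$ and $\eta=\mathfrak f_{\bar z}-(\mathfrak f_{\bar z}\cdot\bar{\mathfrak f})\mathfrak f$. If $f=\pi\circ\mathfrak f$ is a conformal immersion with induced metric $2e^{\omega}dz\,d\bar z$, put $a=e^{-\omega}\xi\cdot\bar\xi$, $b=e^{-\omega}\eta\cdot\bar\eta$. The complex points of $f$ are the points where the Kähler angle $\theta=2\arccos\sqrt{a/2}$ is $0$ or $\pi$; if there are none, the frame of $\mathfrak f$ is $$\mathcal F(\mathfrak f)=(\xi,\eta,\mathfrak f)\,\operatorname{diag}\Big(\tfrac{-ie^{-\omega/2}}{\sqrt a},\tfrac{-ie^{-\omega/2}}{\sqrt b},1\Big).$$ On $\mathfrak{sl}_3\mathbb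 C$ let $\sigma(X)=-PX^TP$ with $$P=\begin{pmatrix}0&\epsilon^2&0\\ \epsilon^4&0&0\\0&0&1\end{pmatrix},\qquad \epsilon=e^{i\pi/3};$$ $\sigma,\sigma^2,\sigma^3$ have orders $6,3,2$. For an automorphism $\kappa$ of order $k\ge2$ let $\mathfrak g_m$ be its eigenspace for the eigenvalue $e^{2\pi im/k}$. A smooth $\hat{\mathcal F}:\mathbb D\to \mathrm{SU}_3$ is called primitive harmonic relative to $\kappa$ if $\hat{\mathcal F}^{-1}d\hat{\mathcal F}=\alpha_{-1}dz+\alpha_0'dz+\alpha_0''d\bar z+\alpha_1d\bar z$ with $\alpha_{\pm1}$ taking values in $\mathfrak g_{\pm1}$ and $\alpha_0',\alpha_0''$ in $\mathfrak g_0$, and if $\lambda^{-1}\alpha_{-1}dz+\alpha_0'dz+\alpha_0''d\bar z+\lambda\alpha_1d\bar z$ satisfies the Maurer–Cartan equation for every $\lambda\in\mathbb C^*$. **Theorem.** Let $\hat{\mathcal F}:\mathbb D\to\mathrm{SU}_3$ be smooth with $\hat{\mathcal F}^{-1}d\hat{\mathcal F}=\hat{\mathcal U}dz+\hat{\mathcal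 V}d\bar z$, where $$\hat{\mathcal U}=\begin{pmatrix}u_{11}+w&u_{12}&u_{13}\\u_{21}&-u_{11}+w&0\\0&u_{32}&-2w\end{pmatrix},\qquad \hat{\mathcal V}=-\overline{\hat{\mathcal U}}^{\,T},$$ and $u_{13}$ and $u_{32}$ vanish nowhere. Then there is a conformal immersion $f:\mathbb D\to\mathbb CP^2$ without complex points such that $\hat{\mathcal F}e_3$ is a lift of $f$, and $\hat{\mathcal F}$ is, up to a diagonal gauge, the frame of a lift of $f$: there are smooth $d_1,d_2,d_3:\mathbb D\to S^1$ with $d_1d_2d_3=1$ such that $\mathfrak f=d_3\hat{\mathcal F}e_3$ is a lift of $f$ and $\mathcal F(\mathfrak f)=\hat{\mathcal F}\operatorname{diag}(d_1,d_2,d_3)$. Moreover: 1. if $\hat{\mathcal F}$ is primitive harmonic relative to $\sigma$, then $f$ is minimal Lagrangian; 2. if $\hat{\mathcal F}$ is primitive harmonic relative to $\sigma^2$, then $f$ is minimal; 3. if $\hat{\mathcal F}$ is primitive harmonic relative to $\sigma^3$, then $f$ is minimal Lagrangian, or $f$ is flat (its induced metric has Gauss curvature $0$) and homogeneous (its image is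 an open part of an orbit of a closed subgroup of $\mathrm{SU}_3$). -/

import Mathlib

open Complex Matrix
open scoped ContDiff LinearAlgebra.Projectivization Topology InnerProductSpace

noncomputable section

namespace CP2Surf

/-- Vectors of `ℂ³`. The Hermitian product of `X` and `Y` is `X ⬝ᵥ star Y`. -/
abbrev C3 := Fin 3 → ℂ

/-- Complex `3 × 3` matrices. -/
abbrev M3 := Matrix (Fin 3) (Fin 3) ℂ

/-- The complex projective plane. -/
abbrev CP2 := ℙ ℂ C3

/-! ### Wirtinger derivatives -/

/-- `∂_z = (∂_x - i ∂_y) / 2`. -/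
def dz {E : Type*} [NormedAddCommGroup E] [NormedSpace ℂ E] (f : ℂ → E) (z : ℂ) : E :=
  (1 / 2 : ℂ) • (fderiv ℝ f z 1 - I • fderiv ℝ f z I)

/-- `∂_z̄ = (∂_x + i ∂_y) / 2`. -/
def dzbar {E : Type*} [NormedAddCommGroup E] [NormedSpace ℂ E] (f : ℂ → E) (z : ℂ) : E :=
  (1 / 2 : ℂ) • (fderiv ℝ f z 1 + I • fderiv ℝ f z I)

/-- `∂_z` of a matrix valued map, entry by entry. -/
def matDz (F : ℂ → M3) (z : ℂ) : M3 := Matrix.of fun i j => dz (fun ζ => F ζ i j) z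

/-- `∂_z̄` of a matrix valued map, entry by entry. -/
def matDzbar (F : ℂ → M3) (z : ℂ) : M3 := Matrix.of fun i j => dzbar (fun ζ => F ζ i j) z

/-! ### Surfaces in the complex projective plane, through lifts to the five-sphere -/

/-- `φ : D → S⁵ ⊂ ℂ³` is a smooth lift of `f : D → ℂP²` for the Hopf fibration. -/
def IsLift (D : Set ℂ) (φ : ℂ → C3) (f : ℂ → CP2) : Prop :=
  ContDiffOn ℝ ∞ φ D ∧
    ∀ z ∈ D, φ z ⬝ᵥ star (φ z) = 1 ∧ ∃ h : φ z ≠ 0, f z = Projectivization.mk ℂ (φ z) h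

/-- Projection of `X ∈ ℂ³` to the Hermitian orthogonal complement of `φ z`, which is the
horizontal space of the Hopf fibration at `φ z`, a copy of the tangent space of `ℂP²`. -/
def hor (φ : ℂ → C3) (z : ℂ) (X : C3) : C3 := X - (X ⬝ᵥ star (φ z)) • φ z

/-- The horizontal representative at `φ z` of the derivative `df(v)` of `f = [φ]`. -/
def tang (φ : ℂ → C3) (v : ℂ) (z : ℂ) : C3 := hor φ z (fderiv ℝ φ z v)

/-- The Fubini-Study metric (holomorphic sectional curvature `4`) pulled back by `f = [φ]`:
`ds² = |dφ|² - (φ̄ · dφ) (φ · dφ̄)`. -/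
def metric (φ : ℂ → C3) (z v w : ℂ) : ℝ :=
  (fderiv ℝ φ z v ⬝ᵥ star (fderiv ℝ φ z w)
    - (fderiv ℝ φ z v ⬝ᵥ star (φ z)) * star (fderiv ℝ φ z w ⬝ᵥ star (φ z))).re

/-- The pullback by `f = [φ]` of the Kähler form `(X, Y) ↦ ⟨i X, Y⟩` of the
Fubini-Study metric. -/
def kahlerForm (φ : ℂ → C3) (z v w : ℂ) : ℝ :=
  ((I • tang φ v z) ⬝ᵥ star (tang φ w z)).re

/-- `f = [φ]` is a conformal immersion on `D`: the pulled back metric is positive definite and a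
multiple of `dx² + dy²`. -/
def ConformalImmersionOn (D : Set ℂ) (φ : ℂ → C3) : Prop :=
  ∀ z ∈ D, (∀ v : ℂ, v ≠ 0 → 0 < metric φ z v v) ∧
    metric φ z 1 1 = metric φ z I I ∧ metric φ z 1 I = 0

/-- The function `ω` of the induced metric `2 e^ω dz dz̄ = 2 e^ω (dx² + dy²)`. -/
def omega (φ : ℂ → C3) (z : ℂ) : ℝ := Real.log (metric φ z 1 1 / 2)

/-- `ξ = φ_z - (φ_z · φ̄) φ`. -/
def xi (φ : ℂ → C3) (z : ℂ) : C3 := dz φ z - (dz φ z ⬝ᵥ star (φ z)) • φ z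

/-- `η = φ_z̄ - (φ_z̄ · φ̄) φ`. -/
def eta (φ : ℂ → C3) (z : ℂ) : C3 := dzbar φ z - (dzbar φ z ⬝ᵥ star (φ z)) • φ z

/-- `a = e^{-ω} ξ · ξ̄`. -/
def aFun (φ : ℂ → C3) (z : ℂ) : ℝ := Real.exp (-omega φ z) * (xi φ z ⬝ᵥ star (xi φ z)).re

/-- `b = e^{-ω} η · η̄`. -/
def bFun (φ : ℂ → C3) (z : ℂ) : ℝ := Real.exp (-omega φ z) * (eta φ z ⬝ᵥ star (eta φ z)).re

/-- The Kähler angle. -/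
def kahlerAngle (φ : ℂ → C3) (z : ℂ) : ℝ := 2 * Real.arccos (Real.sqrt (aFun φ z / 2))

/-- Complex points: holomorphic points (Kähler angle `0`) or anti-holomorphic points (Kähler
angle `π`). -/
def IsComplexPoint (φ : ℂ → C3) (z : ℂ) : Prop :=
  kahlerAngle φ z = 0 ∨ kahlerAngle φ z = Real.pi

/-- The frame `𝓕(φ) = (ξ, η, φ) · diag(-i e^{-ω/2} / √a, -i e^{-ω/2} / √b, 1)` of a lift `φ`. -/
def frame (φ : ℂ → C3) (z : ℂ) : M3 :=
  (Matrix.of ![xi φ z, eta φ z, φ z])ᵀ *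
    Matrix.diagonal ![-I * ((Real.exp (-omega φ z / 2) / Real.sqrt (aFun φ z) : ℝ) : ℂ),
      -I * ((Real.exp (-omega φ z / 2) / Real.sqrt (bFun φ z) : ℝ) : ℂ), 1]

/-- Levi-Civita covariant derivative on `ℂP²`, along `f = [φ]`, in the direction `v`, of the
vector field along `f` with horizontal representative `X` at `φ`. For a horizontal lift this is
the horizontal part of the derivative of `X`; the last term makes the expression equivariant
under `(φ, X) ↦ (h φ, h X)` with `h : D → S¹`, so it is right for every lift. -/
def covDeriv (φ : ℂ → C3) (v : ℂ) (X : ℂ → C3) (z : ℂ) : C3 :=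
  hor φ z (fderiv ℝ X z v) - (fderiv ℝ φ z v ⬝ᵥ star (φ z)) • X z

/-- The component of `Y` normal to the surface, for a conformal immersion `[φ]`: the real
orthogonal projections of `Y` to `df(∂_x)` and `df(∂_y)` are removed. -/
def normalPart (φ : ℂ → C3) (z : ℂ) (Y : C3) : C3 :=
  Y - ((Y ⬝ᵥ star (tang φ 1 z)).re / metric φ z 1 1) • tang φ 1 z
    - ((Y ⬝ᵥ star (tang φ I z)).re / metric φ z I I) • tang φ I z

/-- The mean curvature vector of a conformal immersion `[φ]`: half of the trace, with respect to
the induced metric, of the second fundamental form. -/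
def meanCurvature (φ : ℂ → C3) (z : ℂ) : C3 :=
  (2 * metric φ z 1 1)⁻¹ •
    normalPart φ z (covDeriv φ 1 (tang φ 1) z + covDeriv φ I (tang φ I) z)

/-- The Gauss curvature `-Δ log E / (2 E)` of the conformal metric `E (dx² + dy²)` induced by a
conformal immersion `[φ]`. -/
def gaussCurvature (φ : ℂ → C3) (z : ℂ) : ℝ :=
  -(Laplacian.laplacian (fun ζ => Real.log (metric φ ζ 1 1)) z) / (2 * metric φ z 1 1)

/-! The following notions for `f : D → ℂP²` are read off from a smooth lift to `S⁵`. Each of the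
conditions on the lift is unchanged when `φ` is replaced by `h φ` with `h : D → S¹` smooth. -/

/-- `f` is a (smooth, liftable) conformal immersion into `ℂP²`. -/
def IsConformalImmersion (D : Set ℂ) (f : ℂ → CP2) : Prop :=
  ∃ φ, IsLift D φ f ∧ ConformalImmersionOn D φ

/-- `f` is a conformal immersion without complex points. -/
def IsImmersionWithoutComplexPoints (D : Set ℂ) (f : ℂ → CP2) : Prop :=
  ∃ φ, IsLift D φ f ∧ ConformalImmersionOn D φ ∧ ∀ z ∈ D, ¬ IsComplexPoint φ z

/-- `f` is a minimal conformal immersion: the mean curvature vector vanishes. -/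
def IsMinimal (D : Set ℂ) (f : ℂ → CP2) : Prop :=
  ∃ φ, IsLift D φ f ∧ ConformalImmersionOn D φ ∧ ∀ z ∈ D, meanCurvature φ z = 0

/-- `f` is a Lagrangian conformal immersion: the Kähler form pulls back to zero. -/
def IsLagrangian (D : Set ℂ) (f : ℂ → CP2) : Prop :=
  ∃ φ, IsLift D φ f ∧ ConformalImmersionOn D φ ∧ ∀ z ∈ D, ∀ v w : ℂ, kahlerForm φ z v w = 0

/-- `f` is a conformal immersion whose induced metric is flat. -/
def IsFlat (D : Set ℂ) (f : ℂ → CP2) : Prop :=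
  ∃ φ, IsLift D φ f ∧ ConformalImmersionOn D φ ∧ ∀ z ∈ D, gaussCurvature φ z = 0

/-- A special unitary matrix acts injectively on `ℂ³`. -/
theorem toLin'_injective (g : Matrix.specialUnitaryGroup (Fin 3) ℂ) :
    Function.Injective (Matrix.toLin' (g : M3)) := by
  have h : (g : M3).det = 1 := (Matrix.mem_specialUnitaryGroup_iff.1 g.2).2
  have hu : IsUnit (g : M3) := by
    rw [Matrix.isUnit_iff_isUnit_det, h]
    exact isUnit_one
  change Function.Injective (g : M3).mulVec
  exact Matrix.mulVec_injective_of_isUnit hu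

/-- The isometric action of `SU₃` on `ℂP²`. -/
def act (g : Matrix.specialUnitaryGroup (Fin 3) ℂ) (p : CP2) : CP2 :=
  p.map (Matrix.toLin' (g : M3)) (toLin'_injective g)

/-- `f` is a homogeneous immersion: its image is an open part of an orbit of a closed subgroup `H`
of `SU₃`, that is, `H` relates any two points of the image, and the elements of `H` close to the
identity move a point of the image to points of the image. -/
def IsHomogeneous (D : Set ℂ) (f : ℂ → CP2) : Prop :=
  IsConformalImmersion D f ∧
    ∃ H : Subgroup (Matrix.specialUnitaryGroup (Fin 3) ℂ),
      IsClosed (H : Set (Matrix.specialUnitaryGroup (Fin 3) ℂ)) ∧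
      (∀ p ∈ D, ∀ q ∈ D, ∃ g ∈ H, f q = act g (f p)) ∧
      (∀ p ∈ D, ∀ᶠ g : H in 𝓝 1, act (g : Matrix.specialUnitaryGroup (Fin 3) ℂ) (f p) ∈ f '' D)

/-! ### The automorphism `σ` of `sl₃(ℂ)` and primitive harmonic frames -/

/-- `ε = e^{iπ/3}`. -/
def eps : ℂ := Complex.exp (Real.pi * I / 3)

/-- The matrix `P` in `σ(X) = -P Xᵀ P`. -/
def Pmat : M3 := !![0, eps ^ 2, 0; eps ^ 4, 0, 0; 0, 0, 1]

/-- The automorphism `σ(X) = -P Xᵀ P`, of order `6`, of `sl₃(ℂ)`. Its powers are the iterates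
`sigma^[2]` (of order `3`) and `sigma^[3]` (of order `2`). -/
def sigma (X : M3) : M3 := -(Pmat * Xᵀ * Pmat)

/-- `X` lies in the eigenspace `𝔤_m` of the automorphism `κ` of `sl₃(ℂ)` of order `k`, that is, in
the one for the eigenvalue `e^{2πim/k}`. -/
def InEigenspace (κ : M3 → M3) (k : ℕ) (m : ℤ) (X : M3) : Prop :=
  X.trace = 0 ∧ κ X = (Complex.exp (2 * Real.pi * I / k)) ^ m • X

/-- `A dz + B dz̄` is integrable on `D`: `A_z̄ - B_z = [A, B]`, which is the Maurer-Cartan equation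
`dα + ½ [α ∧ α] = 0` for `α = A dz + B dz̄`. -/
def FormIntegrable (D : Set ℂ) (A B : ℂ → M3) : Prop :=
  ∀ z ∈ D, matDzbar A z - matDz B z = A z * B z - B z * A z

/-- The frame `F` is primitive harmonic relative to the automorphism `κ` of order `k`: one has
`F⁻¹ dF = α₋₁ dz + α₀' dz + α₀'' dz̄ + α₁ dz̄` with `α_m` in `𝔤_m`, and
`λ⁻¹ α₋₁ dz + α₀ + λ α₁ dz̄` is integrable for all `λ ∈ ℂ*`. -/
def IsPrimitiveHarmonic (D : Set ℂ) (κ : M3 → M3) (k : ℕ) (F : ℂ → M3) : Prop :=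
  ∃ αm α0' α0'' αp : ℂ → M3,
    (∀ z ∈ D,
      InEigenspace κ k (-1) (αm z) ∧ InEigenspace κ k 0 (α0' z) ∧
      InEigenspace κ k 0 (α0'' z) ∧ InEigenspace κ k 1 (αp z) ∧
      (F z)⁻¹ * matDz F z = αm z + α0' z ∧
      (F z)⁻¹ * matDzbar F z = α0'' z + αp z) ∧
    ∀ l : ℂ, l ≠ 0 →
      FormIntegrable D (fun z => l⁻¹ • αm z + α0' z) (fun z => α0'' z + l • αp z)

/-- The third column `F e₃` of a matrix valued map. -/
def lastCol (F : ℂ → M3) (z : ℂ) : C3 := F z *ᵥ ![0, 0, 1]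

/-- The `SU₃`-valued map `F` comes from the immersion `f` without complex points: `F e₃` is a lift
of `f`, and up to a diagonal gauge `diag(d₁, d₂, d₃)` in `SU₃`, `F` is the frame of a lift of `f`
(which then is `d₃ F e₃`). -/
def IsDerivedFrom (D : Set ℂ) (F : ℂ → M3) (f : ℂ → CP2) : Prop :=
  IsImmersionWithoutComplexPoints D f ∧ IsLift D (lastCol F) f ∧
    ∃ d : ℂ → Fin 3 → ℂ, ContDiffOn ℝ ∞ d D ∧
      (∀ z ∈ D, (∀ i, ‖d z i‖ = 1) ∧ ∏ i, d z i = 1) ∧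
      IsLift D (fun z => d z 2 • lastCol F z) f ∧
      ∀ z ∈ D, frame (fun ζ => d ζ 2 • lastCol F ζ) z = F z * Matrix.diagonal (d z)

end CP2Surf

end

open CP2Surf

/-! Write F = (X, Y, φ) for the columns. The two zeros of the `dz`-part say that ξ = u₁₃X and η =
-ū₃₂Y, so ξ and η are nonzero and Hermitian orthogonal. Hence [φ] is conformal with metric factor
|u₁₃|² + |u₃₂|², its Kähler form is a multiple of |u₁₃|² - |u₃₂|², and the Kähler angle is never 0
or π. F differs from the frame of φ only by phases. Making the gauge have determinant 1 costs a cube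
root of a circle-valued function, which exists since D is simply connected (`isDerivedFrom`).

By the Maurer-Cartan equation, u₁₂ = 0 gives vanishing mean curvature (`isMinimal`), while |u₁₃| =
|u₃₂| is the Lagrangian condition (`isLagrangian`). The eigenvalue conditions for σ force u₁₂ = 0
and u₁₃ = u₃₂, those for σ² force u₁₂ = 0; this settles cases 1 and 2.

For σ³ put p = (u₁₃ - u₃₂)/2 and q = (u₁₃ + u₃₂)/2. Comparing powers of λ gives w p̄ = 0 and w_z̄ =
-q p̄, so q = 0 wherever p ≠ 0. Since p + q = u₁₃ has no zeros and D is connected, p ≡ 0 or q ≡ 0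
(`sigma_cube_dichotomy`). If q ≡ 0, then u₁₂ = 0 and the surface is minimal Lagrangian. If p ≡ 0,
the surface is Lagrangian, w is holomorphic, and w u₁₂/q² = 3|w|²/|q|² is both real and holomorphic,
hence a constant c. If c = 0, then w = u₁₂ = 0, again minimal Lagrangian.

If c ≠ 0, the metric is a constant times |w|² |dz|² with w holomorphic without zeros, so it is flat.
The Gauss equation makes the odd part A of the form normal, and u₂₁q²/w³ is constant as well.
Therefore M = F (A/w) F* is a constant normal matrix (`exists_const_conj`), and φ_z = wMφ, φ_z̄ =
-w̄M*φ integrate to φ = exp(WM - W̄M*)φ(z₀) locally, with W' = w (`eq_exp_mulVec`). The centralizer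
of M in SU₃ is the required closed group (`isHomogeneous`). -/

namespace CP2Surf

/-! ### Wirtinger calculus -/

section Wirtinger

variable {E : Type*} [NormedAddCommGroup E] [NormedSpace ℂ E]

theorem fderiv_eq_dz_add_dzbar (f : ℂ → E) (z v : ℂ) :
    fderiv ℝ f z v = v • dz f z + star v • dzbar f z := by
  have hv : fderiv ℝ f z v = (v.re : ℂ) • fderiv ℝ f z 1 + (v.im : ℂ) • fderiv ℝ f z I := by
    have h : v = v.re • (1 : ℂ) + v.im • I := by
      apply Complex.ext <;> simp
    conv_lhs => rw [h, map_add, map_smul, map_smul]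
    simp only [Complex.coe_smul]
  have e : v = v.re + v.im * I := (Complex.re_add_im v).symm
  have e2 : star v = v.re - v.im * I := by
    apply Complex.ext <;> simp
  have hI : I * I = -1 := Complex.I_mul_I
  have key (a b : ℂ) (x y : E) :
      a • x + b • y = (a + b * I) • (1 / 2 : ℂ) • (x - I • y)
        + (a - b * I) • (1 / 2 : ℂ) • (x + I • y) := by
    match_scalars
    · ring
    · linear_combination b * hI
  rw [hv, dz, dzbar, e2, key, ← e]

theorem dz_congr {f g : ℂ → E} {z : ℂ} (h : f =ᶠ[𝓝 z] g) : dz f z = dz g z := by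
  rw [dz, dz, h.fderiv_eq]

theorem dzbar_congr {f g : ℂ → E} {z : ℂ} (h : f =ᶠ[𝓝 z] g) : dzbar f z = dzbar g z := by
  rw [dzbar, dzbar, h.fderiv_eq]

theorem dz_add {f g : ℂ → E} {z : ℂ} (hf : DifferentiableAt ℝ f z) (hg : DifferentiableAt ℝ g z) :
    dz (fun ζ => f ζ + g ζ) z = dz f z + dz g z := by
  simp only [dz, fderiv_fun_add hf hg, _root_.add_apply]
  module

theorem dzbar_add {f g : ℂ → E} {z : ℂ} (hf : DifferentiableAt ℝ f z)
    (hg : DifferentiableAt ℝ g z) :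
    dzbar (fun ζ => f ζ + g ζ) z = dzbar f z + dzbar g z := by
  simp only [dzbar, fderiv_fun_add hf hg, _root_.add_apply]
  module

theorem dz_smul {f : ℂ → ℂ} {g : ℂ → E} {z : ℂ} (hf : DifferentiableAt ℝ f z)
    (hg : DifferentiableAt ℝ g z) :
    dz (fun ζ => f ζ • g ζ) z = dz f z • g z + f z • dz g z := by
  simp only [dz, fderiv_fun_smul hf hg, _root_.add_apply,
    _root_.smul_apply, ContinuousLinearMap.smulRight_apply, smul_eq_mul]
  module

theorem dzbar_smul {f : ℂ → ℂ} {g : ℂ → E} {z : ℂ} (hf : DifferentiableAt ℝ f z)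
    (hg : DifferentiableAt ℝ g z) :
    dzbar (fun ζ => f ζ • g ζ) z = dzbar f z • g z + f z • dzbar g z := by
  simp only [dzbar, fderiv_fun_smul hf hg, _root_.add_apply,
    _root_.smul_apply, ContinuousLinearMap.smulRight_apply, smul_eq_mul]
  module

theorem dz_mul {f g : ℂ → ℂ} {z : ℂ} (hf : DifferentiableAt ℝ f z) (hg : DifferentiableAt ℝ g z) :
    dz (fun ζ => f ζ * g ζ) z = dz f z * g z + f z * dz g z :=
  dz_smul hf hg

theorem dzbar_mul {f g : ℂ → ℂ} {z : ℂ} (hf : DifferentiableAt ℝ f z)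
    (hg : DifferentiableAt ℝ g z) :
    dzbar (fun ζ => f ζ * g ζ) z = dzbar f z * g z + f z * dzbar g z :=
  dzbar_smul hf hg

@[simp] theorem dz_const (c : E) (z : ℂ) : dz (fun _ => c) z = 0 := by simp [dz]

@[simp] theorem dzbar_const (c : E) (z : ℂ) : dzbar (fun _ => c) z = 0 := by simp [dzbar]

theorem dz_const_mul {f : ℂ → ℂ} {z : ℂ} (c : ℂ) (hf : DifferentiableAt ℝ f z) :
    dz (fun ζ => c * f ζ) z = c * dz f z := by
  rw [dz_mul (differentiableAt_const c) hf]; simp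

theorem dzbar_const_mul {f : ℂ → ℂ} {z : ℂ} (c : ℂ) (hf : DifferentiableAt ℝ f z) :
    dzbar (fun ζ => c * f ζ) z = c * dzbar f z := by
  rw [dzbar_mul (differentiableAt_const c) hf]; simp

theorem dz_neg (f : ℂ → E) (z : ℂ) : dz (fun ζ => -f ζ) z = -dz f z := by
  simp only [dz, fderiv_fun_neg, _root_.neg_apply]
  module

theorem dzbar_neg (f : ℂ → E) (z : ℂ) : dzbar (fun ζ => -f ζ) z = -dzbar f z := by
  simp only [dzbar, fderiv_fun_neg, _root_.neg_apply]
  module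

theorem fderiv_star_apply {f : ℂ → ℂ} {z v : ℂ} :
    fderiv ℝ (fun ζ => star (f ζ)) z v = star (fderiv ℝ f z v) := by
  rw [fderiv_star]; rfl

theorem dz_star (f : ℂ → ℂ) (z : ℂ) : dz (fun ζ => star (f ζ)) z = star (dzbar f z) := by
  simp only [dz, dzbar, fderiv_star_apply, smul_eq_mul, star_mul', star_add]
  simp
  ring

theorem dzbar_star (f : ℂ → ℂ) (z : ℂ) : dzbar (fun ζ => star (f ζ)) z = star (dz f z) := by
  simp only [dz, dzbar, fderiv_star_apply, smul_eq_mul, star_mul', star_sub]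
  simp

theorem dz_apply {φ : ℂ → C3} {z : ℂ} (h : DifferentiableAt ℝ φ z) (i : Fin 3) :
    dz φ z i = dz (fun ζ => φ ζ i) z := by
  simp only [dz, Pi.smul_apply, Pi.sub_apply]
  rw [fderiv_apply h i]
  rfl

theorem dzbar_apply {φ : ℂ → C3} {z : ℂ} (h : DifferentiableAt ℝ φ z) (i : Fin 3) :
    dzbar φ z i = dzbar (fun ζ => φ ζ i) z := by
  simp only [dzbar, Pi.smul_apply, Pi.add_apply]
  rw [fderiv_apply h i]
  rfl

theorem fderiv_eq_zero_of_dz {f : ℂ → E} {z : ℂ} (h : dz f z = 0) (h' : dzbar f z = 0) :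
    fderiv ℝ f z = 0 := by
  ext v
  simp [fderiv_eq_dz_add_dzbar f z, h, h']

theorem dz_inv {f : ℂ → ℂ} {z : ℂ} (hf : DifferentiableAt ℝ f z) (h0 : f z ≠ 0) :
    dz (fun ζ => (f ζ)⁻¹) z = -dz f z / f z ^ 2 := by
  have h1 : dz (fun ζ => f ζ * (f ζ)⁻¹) z = 0 := by
    rw [dz_congr (g := fun _ => (1 : ℂ)), dz_const]
    filter_upwards [hf.continuousAt.eventually_ne h0] with ζ hζ using mul_inv_cancel₀ hζ
  have h2 : DifferentiableAt ℝ (fun ζ => (f ζ)⁻¹) z := hf.inv h0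
  rw [dz_mul hf h2] at h1
  field_simp at h1 ⊢
  linear_combination h1

theorem dzbar_inv {f : ℂ → ℂ} {z : ℂ} (hf : DifferentiableAt ℝ f z) (h0 : f z ≠ 0) :
    dzbar (fun ζ => (f ζ)⁻¹) z = -dzbar f z / f z ^ 2 := by
  have h1 : dzbar (fun ζ => f ζ * (f ζ)⁻¹) z = 0 := by
    rw [dzbar_congr (g := fun _ => (1 : ℂ)), dzbar_const]
    filter_upwards [hf.continuousAt.eventually_ne h0] with ζ hζ using mul_inv_cancel₀ hζ
  have h2 : DifferentiableAt ℝ (fun ζ => (f ζ)⁻¹) z := hf.inv h0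
  rw [dzbar_mul hf h2] at h1
  field_simp at h1 ⊢
  linear_combination h1

theorem contDiffOn_dz {f : ℂ → E} {D : Set ℂ} (hD : IsOpen D) (hf : ContDiffOn ℝ ∞ f D) :
    ContDiffOn ℝ ∞ (dz f) D := by
  have h : ContDiffOn ℝ ∞ (fderiv ℝ f) D := hf.fderiv_of_isOpen hD le_rfl
  have h1 (v : ℂ) : ContDiffOn ℝ ∞ (fun z => fderiv ℝ f z v) D := h.clm_apply contDiffOn_const
  exact contDiffOn_const.smul ((h1 1).sub (contDiffOn_const.smul (h1 I)))

theorem dz_dzbar_comm {f : ℂ → ℂ} {D : Set ℂ} (hD : IsOpen D) (hf : ContDiffOn ℝ ∞ f D)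
    {z : ℂ} (hz : z ∈ D) : dz (dzbar f) z = dzbar (dz f) z := by
  have hd : DifferentiableAt ℝ (fderiv ℝ f) z :=
    ((hf.fderiv_of_isOpen hD (m := ∞) le_rfl).contDiffAt (hD.mem_nhds hz)).differentiableAt
      (by simp)
  have hs : IsSymmSndFDerivAt ℝ f z :=
    (hf.contDiffAt (hD.mem_nhds hz)).isSymmSndFDerivAt (by simpa using WithTop.coe_le_coe.2 (le_top : (2 : ℕ∞) ≤ ⊤))
  have h1 (v : ℂ) : HasFDerivAt (fun ζ => fderiv ℝ f ζ v) ((fderiv ℝ (fderiv ℝ f) z).flip v) z := by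
    simpa using hd.hasFDerivAt.clm_apply (hasFDerivAt_const v z)
  have e1 : HasFDerivAt (dz f) _ z := ((h1 1).sub ((h1 I).const_smul I)).const_smul (1 / 2 : ℂ)
  have e2 : HasFDerivAt (dzbar f) _ z := ((h1 1).add ((h1 I).const_smul I)).const_smul (1 / 2 : ℂ)
  have hsym := hs 1 I
  rw [dz, dzbar, e1.fderiv, e2.fderiv]
  simp [hsym]
  ring

end Wirtinger

/-! ### Wirtinger derivatives of matrix-valued maps. -/

section Matrices

theorem matDz_apply (F : ℂ → M3) (z : ℂ) (i j : Fin 3) :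
    matDz F z i j = dz (fun ζ => F ζ i j) z := rfl

theorem matDzbar_apply (F : ℂ → M3) (z : ℂ) (i j : Fin 3) :
    matDzbar F z i j = dzbar (fun ζ => F ζ i j) z := rfl

theorem matDz_congr {F G : ℂ → M3} {z : ℂ} (h : F =ᶠ[𝓝 z] G) : matDz F z = matDz G z := by
  ext i j
  exact dz_congr (h.mono fun ζ hζ => by simp [hζ])

theorem matDzbar_congr {F G : ℂ → M3} {z : ℂ} (h : F =ᶠ[𝓝 z] G) :
    matDzbar F z = matDzbar G z := by
  ext i j
  exact dzbar_congr (h.mono fun ζ hζ => by simp [hζ])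

theorem matDz_mul {F G : ℂ → M3} {z : ℂ} (hF : ∀ i j, DifferentiableAt ℝ (fun ζ => F ζ i j) z)
    (hG : ∀ i j, DifferentiableAt ℝ (fun ζ => G ζ i j) z) :
    matDz (fun ζ => F ζ * G ζ) z = matDz F z * G z + F z * matDz G z := by
  ext i j
  simp only [matDz_apply, Matrix.add_apply, Matrix.mul_apply, Fin.sum_univ_three]
  have h (k) : DifferentiableAt ℝ (fun ζ => F ζ i k * G ζ k j) z := (hF i k).mul (hG k j)
  have h' : DifferentiableAt ℝ (fun ζ => F ζ i 0 * G ζ 0 j + F ζ i 1 * G ζ 1 j) z :=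
    (h 0).add (h 1)
  rw [dz_add h' (h 2), dz_add (h 0) (h 1), dz_mul (hF i 0) (hG 0 j),
    dz_mul (hF i 1) (hG 1 j), dz_mul (hF i 2) (hG 2 j)]
  ring

theorem matDzbar_mul {F G : ℂ → M3} {z : ℂ} (hF : ∀ i j, DifferentiableAt ℝ (fun ζ => F ζ i j) z)
    (hG : ∀ i j, DifferentiableAt ℝ (fun ζ => G ζ i j) z) :
    matDzbar (fun ζ => F ζ * G ζ) z = matDzbar F z * G z + F z * matDzbar G z := by
  ext i j
  simp only [matDzbar_apply, Matrix.add_apply, Matrix.mul_apply, Fin.sum_univ_three]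
  have h (k) : DifferentiableAt ℝ (fun ζ => F ζ i k * G ζ k j) z := (hF i k).mul (hG k j)
  have h' : DifferentiableAt ℝ (fun ζ => F ζ i 0 * G ζ 0 j + F ζ i 1 * G ζ 1 j) z :=
    (h 0).add (h 1)
  rw [dzbar_add h' (h 2), dzbar_add (h 0) (h 1), dzbar_mul (hF i 0) (hG 0 j),
    dzbar_mul (hF i 1) (hG 1 j), dzbar_mul (hF i 2) (hG 2 j)]
  ring

theorem matDz_conjTranspose (F : ℂ → M3) (z : ℂ) :
    matDz (fun ζ => (F ζ)ᴴ) z = (matDzbar F z)ᴴ := by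
  ext i j
  exact dz_star _ z

theorem matDzbar_conjTranspose (F : ℂ → M3) (z : ℂ) :
    matDzbar (fun ζ => (F ζ)ᴴ) z = (matDz F z)ᴴ := by
  ext i j
  exact dzbar_star _ z

end Matrices

/-! ### Lifts with an adapted unitary frame -/

theorem dotProduct_star_comm (X Y : C3) : star (X ⬝ᵥ star Y) = Y ⬝ᵥ star X := by
  simp only [dotProduct, Fin.sum_univ_three, star_add, star_mul', Pi.star_apply, star_star]
  ring

theorem tang_eq (φ : ℂ → C3) (v z : ℂ) : tang φ v z = v • xi φ z + star v • eta φ z := by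
  rw [tang, hor, fderiv_eq_dz_add_dzbar, xi, eta, add_dotProduct, smul_dotProduct,
    smul_dotProduct]
  simp only [smul_eq_mul]
  module

theorem metric_eq_tang {φ : ℂ → C3} {z : ℂ} (h : φ z ⬝ᵥ star (φ z) = 1) (v w : ℂ) :
    metric φ z v w = (tang φ v z ⬝ᵥ star (tang φ w z)).re := by
  rw [metric, tang, tang, hor, hor]
  simp only [star_sub, star_smul, sub_dotProduct, dotProduct_sub, smul_dotProduct,
    dotProduct_smul, h, smul_eq_mul, ← dotProduct_star_comm (fderiv ℝ φ z w) (φ z)]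
  congr 1
  ring

/-- At `z`, the vectors `X`, `Y`, `φ z` form a unitary frame with `ξ = p X` and `η = q Y`. -/
structure AdaptedAt (φ : ℂ → C3) (z : ℂ) (X Y : C3) (p q : ℂ) : Prop where
  unit : φ z ⬝ᵥ star (φ z) = 1
  XX : X ⬝ᵥ star X = 1
  YY : Y ⬝ᵥ star Y = 1
  XY : X ⬝ᵥ star Y = 0
  Xφ : X ⬝ᵥ star (φ z) = 0
  Yφ : Y ⬝ᵥ star (φ z) = 0
  xi_eq : xi φ z = p • X
  eta_eq : eta φ z = q • Y
  hp : p ≠ 0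
  hq : q ≠ 0

namespace AdaptedAt

variable {φ : ℂ → C3} {z : ℂ} {X Y : C3} {p q : ℂ}

theorem YX (h : AdaptedAt φ z X Y p q) : Y ⬝ᵥ star X = 0 := by
  rw [← dotProduct_star_comm, h.XY, star_zero]

/-- Since ξ and η are Hermitian orthogonal, no terms in v w or in its conjugate survive. The real
part is then the conformal metric, and the imaginary part carries the Kähler form. -/
theorem tang_dotProduct (h : AdaptedAt φ z X Y p q) (v w : ℂ) :
    tang φ v z ⬝ᵥ star (tang φ w z) =
      (‖p‖ ^ 2 : ℝ) * (v * star w) + (‖q‖ ^ 2 : ℝ) * (star v * w) := by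
  rw [tang_eq, tang_eq, h.xi_eq, h.eta_eq]
  simp only [star_add, star_smul, add_dotProduct, dotProduct_add, smul_dotProduct,
    dotProduct_smul, h.XX, h.YY, h.XY, h.YX, smul_eq_mul, star_star, mul_zero, add_zero, zero_add,
    mul_one, Complex.ofReal_pow, ← Complex.mul_conj']
  simp only [Complex.star_def]
  ring

theorem metric_eq (h : AdaptedAt φ z X Y p q) (v w : ℂ) :
    metric φ z v w = (‖p‖ ^ 2 + ‖q‖ ^ 2) * (v * star w).re := by
  rw [metric_eq_tang h.unit, h.tang_dotProduct, Complex.add_re, Complex.re_ofReal_mul,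
    Complex.re_ofReal_mul]
  simp
  ring

theorem metric_one (h : AdaptedAt φ z X Y p q) : metric φ z 1 1 = ‖p‖ ^ 2 + ‖q‖ ^ 2 := by
  simp [h.metric_eq]

theorem kahlerForm_eq (h : AdaptedAt φ z X Y p q) (v w : ℂ) :
    kahlerForm φ z v w = (‖p‖ ^ 2 - ‖q‖ ^ 2) * (I * (v * star w)).re := by
  rw [kahlerForm, smul_dotProduct, h.tang_dotProduct, smul_eq_mul, mul_add, Complex.add_re,
    mul_left_comm I ((‖p‖ ^ 2 : ℝ) : ℂ), Complex.re_ofReal_mul,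
    mul_left_comm I ((‖q‖ ^ 2 : ℝ) : ℂ), Complex.re_ofReal_mul]
  simp
  ring

theorem sq_pos (h : AdaptedAt φ z X Y p q) : 0 < ‖p‖ ^ 2 ∧ 0 < ‖q‖ ^ 2 :=
  ⟨pow_pos (norm_pos_iff.2 h.hp) 2, pow_pos (norm_pos_iff.2 h.hq) 2⟩

theorem exp_neg_omega (h : AdaptedAt φ z X Y p q) :
    Real.exp (-omega φ z) = 2 / (‖p‖ ^ 2 + ‖q‖ ^ 2) := by
  have := h.sq_pos
  rw [omega, h.metric_one, Real.exp_neg, Real.exp_log (by linarith), inv_div]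

theorem aFun_eq (h : AdaptedAt φ z X Y p q) :
    aFun φ z = 2 / (‖p‖ ^ 2 + ‖q‖ ^ 2) * ‖p‖ ^ 2 := by
  rw [aFun, h.exp_neg_omega, h.xi_eq, star_smul, smul_dotProduct, dotProduct_smul, h.XX]
  simp [Complex.mul_conj', ← Complex.ofReal_pow]

theorem bFun_eq (h : AdaptedAt φ z X Y p q) :
    bFun φ z = 2 / (‖p‖ ^ 2 + ‖q‖ ^ 2) * ‖q‖ ^ 2 := by
  rw [bFun, h.exp_neg_omega, h.eta_eq, star_smul, smul_dotProduct, dotProduct_smul, h.YY]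
  simp [Complex.mul_conj', ← Complex.ofReal_pow]

theorem exp_half (h : AdaptedAt φ z X Y p q) :
    Real.exp (-omega φ z / 2) = Real.sqrt (2 / (‖p‖ ^ 2 + ‖q‖ ^ 2)) := by
  rw [Real.exp_half, h.exp_neg_omega]

theorem frame_eq (h : AdaptedAt φ z X Y p q) :
    frame φ z = (Matrix.of ![X, Y, φ z])ᵀ *
      Matrix.diagonal ![-I * (p / ‖p‖), -I * (q / ‖q‖), 1] := by
  have hs := h.sq_pos
  have hN : 0 < 2 / (‖p‖ ^ 2 + ‖q‖ ^ 2) := div_pos two_pos (by linarith)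
  have hN' := (Real.sqrt_pos.2 hN).ne'
  -- The scalings e^{-ω/2}/√a and e^{-ω/2}/√b reduce to 1/|p| and 1/|q|, so only the phases of p and
  -- q remain in the frame.
  have key (r : ℝ) (hr : 0 ≤ r) : Real.sqrt (2 / (‖p‖ ^ 2 + ‖q‖ ^ 2)) /
      Real.sqrt (2 / (‖p‖ ^ 2 + ‖q‖ ^ 2) * r ^ 2) = r⁻¹ := by
    rw [Real.sqrt_mul hN.le, Real.sqrt_sq hr]
    field_simp
  rw [frame, h.exp_half, h.aFun_eq, h.bFun_eq, key _ (norm_nonneg _), key _ (norm_nonneg _),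
    h.xi_eq, h.eta_eq]
  ext i j
  rw [Matrix.mul_diagonal, Matrix.mul_diagonal]
  fin_cases j <;> simp <;> ring

theorem not_isComplexPoint (h : AdaptedAt φ z X Y p q) : ¬ IsComplexPoint φ z := by
  have hs := h.sq_pos
  have ha : aFun φ z / 2 = ‖p‖ ^ 2 / (‖p‖ ^ 2 + ‖q‖ ^ 2) := by
    rw [h.aFun_eq]; ring
  have h0 : 0 < aFun φ z / 2 := by
    rw [ha]; exact div_pos hs.1 (by linarith)
  have h1 : aFun φ z / 2 < 1 := by
    rw [ha, div_lt_one (by linarith)]; linarith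
  have h2 : 0 < Real.arccos (Real.sqrt (aFun φ z / 2)) :=
    Real.arccos_pos.2 (by rw [Real.sqrt_lt' one_pos]; linarith)
  have h3 : Real.arccos (Real.sqrt (aFun φ z / 2)) < Real.pi / 2 :=
    Real.arccos_lt_pi_div_two.2 (Real.sqrt_pos.2 h0)
  rintro (h4 | h4) <;> rw [kahlerAngle] at h4 <;> linarith

theorem conformal (h : AdaptedAt φ z X Y p q) :
    (∀ v : ℂ, v ≠ 0 → 0 < metric φ z v v) ∧
      metric φ z 1 1 = metric φ z I I ∧ metric φ z 1 I = 0 := by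
  have hs := h.sq_pos
  refine ⟨fun v hv => ?_, by simp [h.metric_eq], by simp [h.metric_eq]⟩
  rw [h.metric_eq, Complex.star_def, Complex.mul_conj, Complex.ofReal_re]
  have := Complex.normSq_pos.2 hv
  nlinarith

/-- A change of lift adds to φ_z and φ_z̄ only multiples of φ, which the horizontal projection
removes; X and Y can be kept and p, q absorb the phase. -/
theorem smul (h : AdaptedAt φ z X Y p q) {d : ℂ → ℂ} (hd : DifferentiableAt ℝ d z)
    (hφ : DifferentiableAt ℝ φ z) (hn : ‖d z‖ = 1) :
    AdaptedAt (fun ζ => d ζ • φ ζ) z X Y (d z * p) (d z * q) := by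
  have hn' : d z * star (d z) = 1 := by
    rw [Complex.star_def, Complex.mul_conj', hn]; simp
  have hd0 : d z ≠ 0 := left_ne_zero_of_mul_eq_one hn'
  refine ⟨?_, h.XX, h.YY, h.XY, ?_, ?_, ?_, ?_, mul_ne_zero hd0 h.hp, mul_ne_zero hd0 h.hq⟩
  · rw [star_smul, smul_dotProduct, dotProduct_smul, h.unit, smul_eq_mul, smul_eq_mul, mul_one, hn']
  · rw [star_smul, dotProduct_smul, h.Xφ, smul_zero]
  · rw [star_smul, dotProduct_smul, h.Yφ, smul_zero]
  · rw [mul_smul, ← h.xi_eq, xi, xi, dz_smul hd hφ]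
    simp only [star_smul, smul_dotProduct, dotProduct_smul, add_dotProduct, h.unit, smul_eq_mul]
    match_scalars
    · linear_combination (-(dz φ z ⬝ᵥ star (φ z)) * d z - dz d z) * hn'
    · ring
  · rw [mul_smul, ← h.eta_eq, eta, eta, dzbar_smul hd hφ]
    simp only [star_smul, smul_dotProduct, dotProduct_smul, add_dotProduct, h.unit, smul_eq_mul]
    match_scalars
    · linear_combination (-(dzbar φ z ⬝ᵥ star (φ z)) * d z - dzbar d z) * hn'
    · ring

end AdaptedAt

/-! ### Smooth roots on simply connected domains -/

/-- A continuous logarithm exists by simple connectedness. It is smooth because near each point it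
is a constant plus the principal logarithm of g/g(z), whose argument is close to 1. -/
theorem exists_contDiffOn_log {D : Set ℂ} (hDo : IsOpen D) (hDs : IsSimplyConnected D)
    {g : ℂ → ℂ} (hg : ContDiffOn ℝ ∞ g D) (h0 : ∀ z ∈ D, g z ≠ 0) :
    ∃ L : ℂ → ℂ, ContDiffOn ℝ ∞ L D ∧ ∀ z ∈ D, Complex.exp (L z) = g z := by
  obtain ⟨L, hLc, hL⟩ := exists_continuousOn_eqOn_exp_comp hDs hDo hg.continuousOn
    (by rintro ⟨z, hz, h⟩; exact h0 z hz h)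
  refine ⟨L, fun z hz => ContDiffAt.contDiffWithinAt ?_, fun z hz => hL hz⟩
  have hLz : ContinuousAt L z := hLc.continuousAt (hDo.mem_nhds hz)
  have hev : L =ᶠ[𝓝 z] fun ζ => L z + Complex.log (g ζ / g z) := by
    -- Within distance π of L z the imaginary part of the difference stays in the strip where the
    -- principal logarithm inverts exp.
    have h1 : ∀ᶠ ζ in 𝓝 z, ‖L ζ - L z‖ < Real.pi := by
      simpa [dist_eq_norm] using hLz.eventually (Metric.ball_mem_nhds (L z) Real.pi_pos)
    filter_upwards [h1, hDo.mem_nhds hz] with ζ h hζ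
    have him : |(L ζ - L z).im| < Real.pi := (Complex.abs_im_le_norm _).trans_lt h
    have e1 : Complex.exp (L ζ) = g ζ := hL hζ
    have e2 : Complex.exp (L z) = g z := hL hz
    rw [← e1, ← e2, ← Complex.exp_sub, Complex.log_exp (abs_lt.1 him).1 (abs_lt.1 him).2.le]
    ring
  refine ContDiffAt.congr_of_eventuallyEq ?_ hev
  have hgz := hg.contDiffAt (hDo.mem_nhds hz)
  refine contDiffAt_const.add (ContDiffAt.comp (g := Complex.log) z ?_ (hgz.div_const _))
  refine ((Complex.contDiffAt_log ?_).restrict_scalars ℝ)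
  rw [div_self (h0 z hz)]
  exact Complex.one_mem_slitPlane

/-! ### Frames whose Maurer-Cartan form has the special shape -/

/-- The `dz`-part of the Maurer-Cartan form. -/
def formU (u11 w u12 u13 u21 u32 : ℂ → ℂ) (z : ℂ) : M3 :=
  !![u11 z + w z, u12 z, u13 z; u21 z, -u11 z + w z, 0; 0, u32 z, -2 * w z]

/-- The `dz̄`-part of the Maurer-Cartan form. -/
def formV (u11 w u12 u13 u21 u32 : ℂ → ℂ) (z : ℂ) : M3 :=
  !![-star (u11 z) - star (w z), -star (u21 z), 0;
    -star (u12 z), star (u11 z) - star (w z), -star (u32 z);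
    -star (u13 z), 0, 2 * star (w z)]

/-- The map `F : D → SU₃` is smooth, and `F⁻¹ dF` has the special shape. -/
structure IsSpecialFrame (D : Set ℂ) (F : ℂ → M3) (u11 w u12 u13 u21 u32 : ℂ → ℂ) : Prop where
  isOpen : IsOpen D
  smooth : ∀ i j, ContDiffOn ℝ ∞ (fun z => F z i j) D
  mem : ∀ z ∈ D, F z ∈ Matrix.specialUnitaryGroup (Fin 3) ℂ
  inv_dz : ∀ z ∈ D, (F z)⁻¹ * matDz F z = formU u11 w u12 u13 u21 u32 z
  inv_dzbar : ∀ z ∈ D, (F z)⁻¹ * matDzbar F z = formV u11 w u12 u13 u21 u32 z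
  u13_ne : ∀ z ∈ D, u13 z ≠ 0
  u32_ne : ∀ z ∈ D, u32 z ≠ 0

theorem contDiffOn_star {f : ℂ → ℂ} {D : Set ℂ} (hf : ContDiffOn ℝ ∞ f D) :
    ContDiffOn ℝ ∞ (fun z => star (f z)) D :=
  Complex.conjCLE.contDiff.comp_contDiffOn hf

theorem formV_eq (u11 w u12 u13 u21 u32 : ℂ → ℂ) (z : ℂ) :
    formV u11 w u12 u13 u21 u32 z = -(formU u11 w u12 u13 u21 u32 z)ᴴ := by
  ext i j
  fin_cases i <;> fin_cases j <;> simp [formU, formV] <;> ring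

namespace IsSpecialFrame

variable {D : Set ℂ} {F : ℂ → M3} {u11 w u12 u13 u21 u32 : ℂ → ℂ} {z : ℂ}

section

variable (h : IsSpecialFrame D F u11 w u12 u13 u21 u32)
include h

theorem conjTranspose_mul_self (hz : z ∈ D) : (F z)ᴴ * F z = 1 :=
  Matrix.mem_unitaryGroup_iff'.1 (Matrix.mem_specialUnitaryGroup_iff.1 (h.mem z hz)).1

theorem mul_conjTranspose_self (hz : z ∈ D) : F z * (F z)ᴴ = 1 :=
  Matrix.mem_unitaryGroup_iff.1 (Matrix.mem_specialUnitaryGroup_iff.1 (h.mem z hz)).1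

theorem inv_eq (hz : z ∈ D) : (F z)⁻¹ = (F z)ᴴ :=
  Matrix.inv_eq_left_inv (h.conjTranspose_mul_self hz)

theorem matDz_eq (hz : z ∈ D) : matDz F z = F z * formU u11 w u12 u13 u21 u32 z := by
  rw [← h.inv_dz z hz, h.inv_eq hz, ← Matrix.mul_assoc, h.mul_conjTranspose_self hz,
    Matrix.one_mul]

theorem matDzbar_eq (hz : z ∈ D) : matDzbar F z = F z * formV u11 w u12 u13 u21 u32 z := by
  rw [← h.inv_dzbar z hz, h.inv_eq hz, ← Matrix.mul_assoc, h.mul_conjTranspose_self hz,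
    Matrix.one_mul]

theorem differentiableAt (hz : z ∈ D) (i j : Fin 3) :
    DifferentiableAt ℝ (fun ζ => F ζ i j) z :=
  ((h.smooth i j).contDiffAt (h.isOpen.mem_nhds hz)).differentiableAt (by simp)

/-- The coefficients are not assumed smooth: they inherit smoothness from F as the entries of F*F_z.
-/
theorem smooth_formU (i j : Fin 3) :
    ContDiffOn ℝ ∞ (fun z => formU u11 w u12 u13 u21 u32 z i j) D := by
  have h1 : ContDiffOn ℝ ∞ (fun z => ∑ k, star (F z k i) * dz (fun ζ => F ζ k j) z) D :=
    ContDiffOn.sum fun k _ =>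
      (contDiffOn_star (h.smooth k i)).mul (contDiffOn_dz h.isOpen (h.smooth k j))
  refine h1.congr fun z hz => ?_
  rw [← h.inv_dz z hz, h.inv_eq hz, Matrix.mul_apply]
  rfl

theorem smooth_u13 : ContDiffOn ℝ ∞ u13 D := by
  simpa [formU] using h.smooth_formU 0 2

theorem smooth_u32 : ContDiffOn ℝ ∞ u32 D := by
  simpa [formU] using h.smooth_formU 2 1

theorem smooth_u12 : ContDiffOn ℝ ∞ u12 D := by
  simpa [formU] using h.smooth_formU 0 1

theorem smooth_u21 : ContDiffOn ℝ ∞ u21 D := by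
  simpa [formU] using h.smooth_formU 1 0

theorem smooth_w : ContDiffOn ℝ ∞ w D := by
  have h1 : ContDiffOn ℝ ∞ (fun z => -(1 / 2 : ℂ) * (-2 * w z)) D :=
    contDiffOn_const.mul (by simpa [formU] using h.smooth_formU 2 2)
  exact h1.congr fun z _ => by ring

theorem smooth_u11 : ContDiffOn ℝ ∞ u11 D := by
  have h1 : ContDiffOn ℝ ∞ (fun z => u11 z + w z) D := by
    simpa [formU] using h.smooth_formU 0 0
  exact (h1.sub h.smooth_w).congr fun z _ => by ring

theorem differentiableAt_of_smooth {f : ℂ → ℂ} (hf : ContDiffOn ℝ ∞ f D) (hz : z ∈ D) :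
    DifferentiableAt ℝ f z :=
  (hf.contDiffAt (h.isOpen.mem_nhds hz)).differentiableAt (by simp)

theorem smooth_lastCol : ContDiffOn ℝ ∞ (lastCol F) D := by
  refine contDiffOn_pi.2 fun i => (h.smooth i 2).congr fun z _ => ?_
  simp [lastCol, Matrix.mulVec, dotProduct, Fin.sum_univ_three]

theorem col_dotProduct (hz : z ∈ D) (i j : Fin 3) :
    (F z)ᵀ i ⬝ᵥ star ((F z)ᵀ j) = if j = i then 1 else 0 := by
  have h1 := congrFun (congrFun (h.conjTranspose_mul_self hz) j) i
  rw [Matrix.mul_apply, Matrix.one_apply] at h1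
  rw [← h1]
  simp [dotProduct, Fin.sum_univ_three, mul_comm]

end

theorem _root_.CP2Surf.lastCol_eq (F : ℂ → M3) (z : ℂ) : lastCol F z = (F z)ᵀ 2 := by
  ext i
  simp [lastCol, Matrix.mulVec, dotProduct, Fin.sum_univ_three]

section

variable (h : IsSpecialFrame D F u11 w u12 u13 u21 u32)
include h

theorem differentiableAt_col (hz : z ∈ D) (j : Fin 3) :
    DifferentiableAt ℝ (fun ζ => (F ζ)ᵀ j) z :=
  differentiableAt_pi.2 fun i => h.differentiableAt hz i j

theorem dz_col (hz : z ∈ D) (j : Fin 3) :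
    dz (fun ζ => (F ζ)ᵀ j) z = formU u11 w u12 u13 u21 u32 z 0 j • (F z)ᵀ 0 +
      formU u11 w u12 u13 u21 u32 z 1 j • (F z)ᵀ 1 +
      formU u11 w u12 u13 u21 u32 z 2 j • (F z)ᵀ 2 := by
  ext i
  rw [dz_apply (h.differentiableAt_col hz j)]
  have h1 := congrFun (congrFun (h.matDz_eq hz) i) j
  rw [matDz_apply, Matrix.mul_apply, Fin.sum_univ_three] at h1
  simp only [Matrix.transpose_apply, h1, Pi.add_apply, Pi.smul_apply, smul_eq_mul]
  ring

theorem dzbar_col (hz : z ∈ D) (j : Fin 3) :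
    dzbar (fun ζ => (F ζ)ᵀ j) z = formV u11 w u12 u13 u21 u32 z 0 j • (F z)ᵀ 0 +
      formV u11 w u12 u13 u21 u32 z 1 j • (F z)ᵀ 1 +
      formV u11 w u12 u13 u21 u32 z 2 j • (F z)ᵀ 2 := by
  ext i
  rw [dzbar_apply (h.differentiableAt_col hz j)]
  have h1 := congrFun (congrFun (h.matDzbar_eq hz) i) j
  rw [matDzbar_apply, Matrix.mul_apply, Fin.sum_univ_three] at h1
  simp only [Matrix.transpose_apply, h1, Pi.add_apply, Pi.smul_apply, smul_eq_mul]
  ring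

theorem dz_lastCol (hz : z ∈ D) :
    dz (lastCol F) z = u13 z • (F z)ᵀ 0 - (2 * w z) • lastCol F z := by
  rw [show lastCol F = fun ζ => (F ζ)ᵀ 2 from funext (lastCol_eq F), h.dz_col hz 2]
  simp [formU, sub_eq_add_neg]

theorem dzbar_lastCol (hz : z ∈ D) :
    dzbar (lastCol F) z = -star (u32 z) • (F z)ᵀ 1 + (2 * star (w z)) • lastCol F z := by
  rw [show lastCol F = fun ζ => (F ζ)ᵀ 2 from funext (lastCol_eq F), h.dzbar_col hz 2]
  simp [formV]

/-- The third column of the `dz`-part has no Y-component and that of the `dz̄`-part no X-component;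
the φ-components ∓2w, 2w̄ are what the horizontal projection discards. -/
theorem adaptedAt (hz : z ∈ D) :
    AdaptedAt (lastCol F) z ((F z)ᵀ 0) ((F z)ᵀ 1) (u13 z) (-star (u32 z)) := by
  have e := h.col_dotProduct hz
  refine ⟨by simp [lastCol_eq, e], by simp [e], by simp [e], by simp [e], by simp [lastCol_eq, e],
    by simp [lastCol_eq, e], ?_, ?_, h.u13_ne z hz, by simpa using h.u32_ne z hz⟩
  · rw [xi, h.dz_lastCol hz]
    simp [lastCol_eq, sub_dotProduct, smul_dotProduct, e]
  · rw [eta, h.dzbar_lastCol hz]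
    simp [lastCol_eq, add_dotProduct, smul_dotProduct, e]

theorem lastCol_ne_zero (hz : z ∈ D) : lastCol F z ≠ 0 := by
  intro h0
  have := (h.adaptedAt hz).unit
  simp [h0] at this

theorem conformalImmersionOn : ConformalImmersionOn D (lastCol F) :=
  fun _ hz => (h.adaptedAt hz).conformal

/-- The diagonal gauge from a cube root. -/
theorem isDerivedFrom (hDs : IsSimplyConnected D) {f : ℂ → CP2} (hf : IsLift D (lastCol F) f) :
    IsDerivedFrom D F f := by
  have hd13 := h.smooth_u13
  have hd32 := h.smooth_u32
  have hn {v : ℂ → ℂ} (hv : ContDiffOn ℝ ∞ v D) (h0 : ∀ z ∈ D, v z ≠ 0) :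
      ContDiffOn ℝ ∞ (fun z => v z / (‖v z‖ : ℂ)) D := by
    have h1 : ContDiffOn ℝ ∞ (fun z => (‖v z‖ : ℂ)) D :=
      Complex.ofRealCLM.contDiff.comp_contDiffOn (hv.norm ℂ h0)
    have h2 := hv.mul (h1.inv fun z hz => by simpa using h0 z hz)
    exact h2.congr fun z _ => div_eq_mul_inv _ _
  -- By `AdaptedAt.frame_eq` for the lift d₃φ, the gauge must have d₁ = -i d₃u₁₃/|u₁₃| and d₂ = i
  -- d₃ū₃₂/|u₃₂|. Then d₁d₂d₃ = 1 means that d₃³ is the function below, and d₃ = exp(L/3).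
  obtain ⟨L, hLs, hL⟩ := exists_contDiffOn_log h.isOpen hDs
    (g := fun z => star (u13 z / (‖u13 z‖ : ℂ)) * (u32 z / (‖u32 z‖ : ℂ)))
    ((contDiffOn_star (hn hd13 h.u13_ne)).mul (hn hd32 h.u32_ne)) (fun z hz => by
      simp [h.u13_ne z hz, h.u32_ne z hz])
  set d3 : ℂ → ℂ := fun z => Complex.exp (L z / 3) with hd3
  have hd3s : ContDiffOn ℝ ∞ d3 D := (hLs.div_const 3).cexp
  have hcube (z) (hz : z ∈ D) :
      d3 z ^ 3 = star (u13 z / (‖u13 z‖ : ℂ)) * (u32 z / (‖u32 z‖ : ℂ)) := by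
    rw [← hL z hz, hd3, ← Complex.exp_nat_mul]
    congr 1
    push_cast
    ring
  have hu' (v : ℂ) (h0 : v ≠ 0) : ‖v / (‖v‖ : ℂ)‖ = 1 := by
    rw [norm_div, Complex.norm_real, norm_norm, div_self (norm_ne_zero_iff.2 h0)]
  have hnorm (z) (hz : z ∈ D) : ‖d3 z‖ = 1 := by
    have : ‖d3 z‖ ^ 3 = 1 := by
      rw [← norm_pow, hcube z hz, norm_mul, norm_star, hu' _ (h.u13_ne z hz),
        hu' _ (h.u32_ne z hz), one_mul]
    exact (pow_eq_one_iff_of_nonneg (norm_nonneg _) (by norm_num)).1 this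
  refine ⟨⟨lastCol F, hf, h.conformalImmersionOn, fun z hz => (h.adaptedAt hz).not_isComplexPoint⟩,
    hf, fun z => ![-I * (d3 z * (u13 z / (‖u13 z‖ : ℂ))),
      I * (d3 z * star (u32 z / (‖u32 z‖ : ℂ))), d3 z], ?_, ?_, ?_, ?_⟩
  · refine contDiffOn_pi.2 fun i => ?_
    fin_cases i
    · exact contDiffOn_const.mul (hd3s.mul (hn hd13 h.u13_ne))
    · exact contDiffOn_const.mul (hd3s.mul (contDiffOn_star (hn hd32 h.u32_ne)))
    · exact hd3s
  · intro z hz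
    beta_reduce
    have e1 := hu' _ (h.u13_ne z hz)
    have e2 := hu' _ (h.u32_ne z hz)
    have hc := hcube z hz
    have e3 := hnorm z hz
    generalize u13 z / (‖u13 z‖ : ℂ) = a at *
    generalize u32 z / (‖u32 z‖ : ℂ) = b at *
    have ha : a * star a = 1 := by rw [Complex.star_def, Complex.mul_conj', e1]; simp
    have hb : b * star b = 1 := by rw [Complex.star_def, Complex.mul_conj', e2]; simp
    constructor
    · intro i
      fin_cases i
      · change ‖-I * (d3 z * a)‖ = 1
        simp [e1, e3]
      · change ‖I * (d3 z * star b)‖ = 1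
        simp [e2, e3]
      · exact e3
    · rw [Fin.prod_univ_three]
      change -I * (d3 z * a) * (I * (d3 z * star b)) * d3 z = 1
      linear_combination (-I * I * a * star b) * hc - I * I * b * star b * ha - I * I * hb
        - Complex.I_mul_I
  · refine ⟨hd3s.smul h.smooth_lastCol, fun z hz => ?_⟩
    have ha := (h.adaptedAt hz).smul (h.differentiableAt_of_smooth hd3s hz)
      ((h.smooth_lastCol.contDiffAt (h.isOpen.mem_nhds hz)).differentiableAt (by simp)) (hnorm z hz)
    refine ⟨ha.unit, fun h0 => ?_, ?_⟩
    · have := ha.unit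
      change (d3 z • lastCol F z) ⬝ᵥ star (d3 z • lastCol F z) = 1 at this
      change d3 z • lastCol F z = 0 at h0
      simp [h0] at this
    · obtain ⟨h0, hfz⟩ := (hf.2 z hz).2
      rw [hfz, Projectivization.mk_eq_mk_iff']
      refine ⟨(d3 z)⁻¹, ?_⟩
      change (d3 z)⁻¹ • d3 z • lastCol F z = _
      rw [inv_smul_smul₀ (Complex.exp_ne_zero _)]
  · intro z hz
    have ha := (h.adaptedAt hz).smul (h.differentiableAt_of_smooth hd3s hz)
      ((h.smooth_lastCol.contDiffAt (h.isOpen.mem_nhds hz)).differentiableAt (by simp)) (hnorm z hz)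
    change frame (fun ζ => d3 ζ • lastCol F ζ) z = _
    rw [ha.frame_eq]
    ext i j
    rw [Matrix.mul_diagonal, Matrix.mul_diagonal]
    have e3 := hnorm z hz
    fin_cases j
    · simp [e3]
      left
      ring
    · simp [e3]
      ring
    · simp [lastCol_eq]
      ring

theorem isLagrangian {f : ℂ → CP2} (hf : IsLift D (lastCol F) f)
    (heq : ∀ z ∈ D, ‖u13 z‖ = ‖u32 z‖) : IsLagrangian D f := by
  refine ⟨lastCol F, hf, h.conformalImmersionOn, fun z hz v v' => ?_⟩
  rw [(h.adaptedAt hz).kahlerForm_eq, norm_neg, norm_star, heq z hz]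
  ring

end

end IsSpecialFrame

/-! ### The mean curvature of a special frame -/

/-- This is the trace of the second derivative in complex form, 2∇_z̄ξ + 2∇_zη: the terms ∇_zξ and
∇_z̄η carry the factors v² and v̄², whose sums over v = 1, i are zero. -/
theorem covDeriv_add_covDeriv {φ ξ η : ℂ → C3} {z : ℂ}
    (hξ : DifferentiableAt ℝ ξ z) (hη : DifferentiableAt ℝ η z)
    (hξe : xi φ =ᶠ[𝓝 z] ξ) (hηe : eta φ =ᶠ[𝓝 z] η) :
    covDeriv φ 1 (tang φ 1) z + covDeriv φ I (tang φ I) z =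
      (2 : ℂ) • (hor φ z (dzbar ξ z) - (dzbar φ z ⬝ᵥ star (φ z)) • ξ z) +
      (2 : ℂ) • (hor φ z (dz η z) - (dz φ z ⬝ᵥ star (φ z)) • η z) := by
  have ht (v : ℂ) : tang φ v =ᶠ[𝓝 z] fun ζ => v • ξ ζ + star v • η ζ := by
    filter_upwards [hξe, hηe] with ζ h1 h2
    rw [tang_eq, h1, h2]
  have hd (v : ℂ) : fderiv ℝ (tang φ v) z v =
      v • (v • dz ξ z + star v • dzbar ξ z) + star v • (v • dz η z + star v • dzbar η z) := by
    have h1 : DifferentiableAt ℝ (fun ζ => v • ξ ζ) z := hξ.const_smul v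
    have h2 : DifferentiableAt ℝ (fun ζ => star v • η ζ) z := hη.const_smul (star v)
    rw [(ht v).fderiv_eq, fderiv_fun_add h1 h2,
      fderiv_fun_const_smul hξ, fderiv_fun_const_smul hη]
    simp only [_root_.add_apply, _root_.smul_apply, fderiv_eq_dz_add_dzbar ξ,
      fderiv_eq_dz_add_dzbar η]
  have hI : I * I = -1 := Complex.I_mul_I
  have hs : star I = -I := Complex.conj_I
  rw [covDeriv, covDeriv, hd, hd, (ht 1).eq_of_nhds, (ht I).eq_of_nhds,
    fderiv_eq_dz_add_dzbar φ, fderiv_eq_dz_add_dzbar φ, hs, star_one]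
  simp only [hor, add_dotProduct, smul_dotProduct, smul_eq_mul]
  match_scalars <;> ring_nf <;> simp only [Complex.I_sq] <;> ring

namespace IsSpecialFrame

variable {D : Set ℂ} {F : ℂ → M3} {u11 w u12 u13 u21 u32 : ℂ → ℂ} {z : ℂ}

/-- Both ∇_z̄ξ and ∇_zη vanish. The Y-component of the first and the X-component of the second
contain u₁₂ as a factor (up to conjugation); the remaining components cancel by the Maurer-Cartan
equations for u₁₃ and u₃₂. -/
theorem isMinimal (h : IsSpecialFrame D F u11 w u12 u13 u21 u32)
    (hint : FormIntegrable D (formU u11 w u12 u13 u21 u32) (formV u11 w u12 u13 u21 u32))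
    (h0 : ∀ z ∈ D, u12 z = 0) {f : ℂ → CP2} (hf : IsLift D (lastCol F) f) : IsMinimal D f := by
  refine ⟨lastCol F, hf, h.conformalImmersionOn, fun z hz => ?_⟩
  have hDz := h.isOpen.mem_nhds hz
  have h13 := h.differentiableAt_of_smooth h.smooth_u13 hz
  have h32 := h.differentiableAt_of_smooth (contDiffOn_star h.smooth_u32).neg hz
  have hX := h.differentiableAt_col hz 0
  have hY := h.differentiableAt_col hz 1
  have e := h.col_dotProduct hz
  -- Entries (0,2) and (1,2) of the Maurer-Cartan equation each involve a single derivative, because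
  -- the `dz̄`-part vanishes at the first and the `dz`-part at the second.
  have e13 : dzbar u13 z = (3 * star (w z) + star (u11 z)) * u13 z := by
    have := congrFun (congrFun (hint z hz) 0) 2
    simp only [Matrix.sub_apply, matDz_apply, matDzbar_apply, Matrix.mul_apply, formU, formV,
      Fin.sum_univ_three] at this
    simp [h0 z hz] at this
    rw [this, Complex.star_def]
    ring
  have e32 : dz (fun ζ => -star (u32 ζ)) z = (3 * w z - u11 z) * star (u32 z) := by
    have := congrFun (congrFun (hint z hz) 1) 2
    simp only [Matrix.sub_apply, matDz_apply, matDzbar_apply, Matrix.mul_apply, formU, formV,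
      Fin.sum_univ_three] at this
    simp [h0 z hz] at this
    simp only [Complex.star_def]
    linear_combination -this
  have key := covDeriv_add_covDeriv (ξ := fun ζ => u13 ζ • (F ζ)ᵀ 0)
    (η := fun ζ => (-star (u32 ζ)) • (F ζ)ᵀ 1) (h13.smul hX) (h32.smul hY)
    (by filter_upwards [hDz] with ζ hζ using (h.adaptedAt hζ).xi_eq)
    (by filter_upwards [hDz] with ζ hζ using (h.adaptedAt hζ).eta_eq)
  rw [dzbar_smul h13 hX, dz_smul h32 hY, h.dzbar_col hz, h.dz_col hz, h.dz_lastCol hz,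
    h.dzbar_lastCol hz, e13, e32] at key
  have hsum : covDeriv (lastCol F) 1 (tang (lastCol F) 1) z +
      covDeriv (lastCol F) I (tang (lastCol F) I) z = 0 := by
    rw [key]
    simp only [hor, lastCol_eq, add_dotProduct, sub_dotProduct, smul_dotProduct, e, smul_eq_mul,
      formU, formV]
    simp [h0 z hz]
    match_scalars <;> simp <;> ring
  rw [meanCurvature, hsum]
  simp [normalPart]

end IsSpecialFrame

/-! ### The eigenspaces of `σ`, `σ²` and `σ³` -/

theorem sigma_eq (X : M3) : sigma X =
    !![-(eps ^ 6 * X 1 1), -(eps ^ 4 * X 0 1), -(eps ^ 2 * X 2 1);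
      -(eps ^ 8 * X 1 0), -(eps ^ 6 * X 0 0), -(eps ^ 4 * X 2 0);
      -(eps ^ 4 * X 1 2), -(eps ^ 2 * X 0 2), -X 2 2] := by
  ext i j
  simp only [sigma, Pmat, Matrix.neg_apply, Matrix.mul_apply, Fin.sum_univ_three,
    Matrix.transpose_apply]
  fin_cases i <;> fin_cases j <;> simp <;> ring

theorem eps_eq : eps = Complex.exp (2 * Real.pi * I / 6) := by
  rw [eps]
  congr 1
  ring

theorem eps_primitive : IsPrimitiveRoot eps 6 := by
  rw [eps_eq]
  exact_mod_cast Complex.isPrimitiveRoot_exp 6 (by norm_num)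

theorem eps_sq : Complex.exp (2 * Real.pi * I / 3) = eps ^ 2 := by
  rw [eps, ← Complex.exp_nat_mul]
  congr 1
  push_cast
  ring

theorem eps_cube : eps ^ 3 = -1 := by
  rw [eps, ← Complex.exp_nat_mul, ← Complex.exp_pi_mul_I]
  congr 1
  push_cast
  ring

theorem eps_ne_one : eps ≠ 1 := eps_primitive.ne_one (by norm_num)

theorem eps_sq_ne_one : eps ^ 2 ≠ 1 :=
  fun h => absurd (eps_primitive.dvd_of_pow_eq_one 2 h) (by norm_num)

theorem eps_pow_four_ne_one : eps ^ 4 ≠ 1 :=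
  fun h => absurd (eps_primitive.dvd_of_pow_eq_one 4 h) (by norm_num)

theorem sigma_sq_zero_one (X : M3) : sigma^[2] X 0 1 = eps ^ 2 * X 0 1 := by
  simp only [Function.iterate_succ, Function.iterate_zero, Function.comp, id]
  rw [sigma_eq (sigma X), sigma_eq X]
  simp
  linear_combination (X 0 1 * eps ^ 2 * (eps ^ 3 - 1)) * eps_cube

theorem sigma_cube (X : M3) : sigma^[3] X =
    !![-X 1 1, -X 0 1, -X 2 1; -X 1 0, -X 0 0, -X 2 0; -X 1 2, -X 0 2, -X 2 2] := by
  have h6 : eps ^ 6 = 1 := eps_primitive.pow_eq_one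
  have h8 : eps ^ 8 = eps ^ 2 := by linear_combination eps ^ 2 * h6
  have h42 : eps ^ 4 * eps ^ 2 = 1 := by linear_combination h6
  have h24 : eps ^ 2 * eps ^ 4 = 1 := by linear_combination h6
  have h44 : eps ^ 4 * eps ^ 4 = eps ^ 2 := by linear_combination eps ^ 2 * h6
  have h22 : eps ^ 2 * eps ^ 2 = eps ^ 4 := by ring
  simp only [Function.iterate_succ, Function.iterate_zero, Function.comp, id]
  rw [sigma_eq (sigma (sigma X)), sigma_eq (sigma X), sigma_eq X]
  ext i j
  fin_cases i <;> fin_cases j <;> simp [h6, h8, ← mul_assoc, h42, h24, h44, h22]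

theorem formIntegrable_congr {D : Set ℂ} (hD : IsOpen D) {A B A' B' : ℂ → M3}
    (hA : ∀ z ∈ D, A z = A' z) (hB : ∀ z ∈ D, B z = B' z) (h : FormIntegrable D A B) :
    FormIntegrable D A' B' := by
  intro z hz
  have hDz := hD.mem_nhds hz
  have eA : A =ᶠ[𝓝 z] A' := by filter_upwards [hDz] with ζ hζ using hA ζ hζ
  have eB : B =ᶠ[𝓝 z] B' := by filter_upwards [hDz] with ζ hζ using hB ζ hζ
  rw [← matDzbar_congr eA, ← matDz_congr eB, h z hz, hA z hz, hB z hz]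

namespace IsSpecialFrame

variable {D : Set ℂ} {F : ℂ → M3} {u11 w u12 u13 u21 u32 : ℂ → ℂ}

section

variable (h : IsSpecialFrame D F u11 w u12 u13 u21 u32)
include h

/-- The value λ = 1 of the loop parameter gives back the form of F itself. -/
theorem formIntegrable_of_isPrimitiveHarmonic {κ : M3 → M3} {k : ℕ}
    (hp : IsPrimitiveHarmonic D κ k F) :
    FormIntegrable D (formU u11 w u12 u13 u21 u32) (formV u11 w u12 u13 u21 u32) := by
  obtain ⟨αm, α0', α0'', αp, h1, h2⟩ := hp
  refine formIntegrable_congr h.isOpen ?_ ?_ (h2 1 one_ne_zero)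
  · intro z hz
    rw [inv_one, one_smul, ← (h1 z hz).2.2.2.2.1, h.inv_dz z hz]
  · intro z hz
    rw [one_smul, ← (h1 z hz).2.2.2.2.2, h.inv_dzbar z hz]

/-- The (0,1) matrix unit is an eigenvector of σ² for ε² = e^{2πi/3}, the eigenvalue of 𝔤₁, whereas
the `dz`-part lives in 𝔤₋₁ ⊕ 𝔤₀. -/
theorem u12_eq_zero_of_sigma_sq (hp : IsPrimitiveHarmonic D (sigma^[2]) 3 F) :
    ∀ z ∈ D, u12 z = 0 := by
  obtain ⟨αm, α0', α0'', αp, h1, -⟩ := hp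
  intro z hz
  obtain ⟨⟨-, hm⟩, ⟨-, h0⟩, -, -, hU, -⟩ := h1 z hz
  have e := congrFun (congrFun ((h.inv_dz z hz).symm.trans hU) 0) 1
  have hm' := congrFun (congrFun hm 0) 1
  have h0' := congrFun (congrFun h0 0) 1
  rw [sigma_sq_zero_one] at hm' h0'
  push_cast at hm' h0'
  rw [eps_sq] at hm' h0'
  simp [formU] at e hm' h0'
  have hne : eps ^ 2 ≠ 0 := pow_ne_zero 2 (eps_primitive.ne_zero (by norm_num))
  have em : αm z 0 1 = 0 := by
    -- The first alternative, ε² = ε⁻², would give ε⁴ = 1.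
    rcases hm' with hm' | hm'
    · have h4 := mul_inv_cancel₀ hne
      rw [← hm'] at h4
      exact absurd (by linear_combination h4) eps_pow_four_ne_one
    · exact hm'
  have e0 : α0' z 0 1 = 0 := by
    have : (eps ^ 2 - 1) * α0' z 0 1 = 0 := by linear_combination h0'
    exact (mul_eq_zero.1 this).resolve_left (sub_ne_zero.2 eps_sq_ne_one)
  rw [e, em, e0, add_zero]

/-- The (0,1) matrix unit has σ-eigenvalue -ε⁴ = ε, which is that of 𝔤₁, so u₁₂ = 0. σ exchanges the
entries (0,2) and (2,1) with factor -ε²: on 𝔤₋₁ this makes them equal since ε³ = -1, and on 𝔤₀ it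
makes both vanish since ε⁴ ≠ 1. -/
theorem of_sigma (hp : IsPrimitiveHarmonic D sigma 6 F) :
    ∀ z ∈ D, u12 z = 0 ∧ u13 z = u32 z := by
  obtain ⟨αm, α0', α0'', αp, h1, -⟩ := hp
  intro z hz
  obtain ⟨⟨-, hm⟩, ⟨-, h0⟩, -, -, hU, -⟩ := h1 z hz
  have hUU := (h.inv_dz z hz).symm.trans hU
  have e1 := congrFun (congrFun hUU 0) 1
  have e2 := congrFun (congrFun hUU 0) 2
  have e3 := congrFun (congrFun hUU 2) 1
  rw [sigma_eq] at hm h0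
  push_cast at hm h0
  rw [← eps_eq] at hm h0
  have m1 := congrFun (congrFun hm 0) 1
  have m2 := congrFun (congrFun hm 0) 2
  have z1 := congrFun (congrFun h0 0) 1
  have z2 := congrFun (congrFun h0 0) 2
  have z3 := congrFun (congrFun h0 2) 1
  have h3 := eps_cube
  have hne : eps ≠ 0 := eps_primitive.ne_zero (by norm_num)
  simp [formU] at e1 e2 e3 m1 m2 z1 z2 z3
  field_simp at m1 m2
  have a1 : αm z 0 1 = 0 := by
    have : (eps ^ 2 - 1) * αm z 0 1 = 0 := by
      linear_combination m1 + αm z 0 1 * eps ^ 2 * h3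
    exact (mul_eq_zero.1 this).resolve_left (sub_ne_zero.2 eps_sq_ne_one)
  have a2 : α0' z 0 1 = 0 := by
    have : (eps - 1) * α0' z 0 1 = 0 := by
      linear_combination z1 + α0' z 0 1 * eps * h3
    exact (mul_eq_zero.1 this).resolve_left (sub_ne_zero.2 eps_ne_one)
  have a3 : α0' z 0 2 = 0 := by
    have : (eps ^ 4 - 1) * α0' z 0 2 = 0 := by
      linear_combination z2 - eps ^ 2 * z3
    exact (mul_eq_zero.1 this).resolve_left (sub_ne_zero.2 eps_pow_four_ne_one)
  have a4 : α0' z 2 1 = 0 := by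
    rw [← z3, a3]; simp
  have a5 : αm z 0 2 = αm z 2 1 := by
    linear_combination -m2 - αm z 2 1 * h3
  constructor
  · rw [e1, a1, a2, add_zero]
  · rw [e2, e3, a3, a4, a5]

end

end IsSpecialFrame

/-! ### Primitive harmonic frames relative to `σ³` -/

/-- The component in `𝔤₋₁` of the `dz`-part. -/
def formA (w u12 u21 q : ℂ → ℂ) (z : ℂ) : M3 :=
  !![w z, u12 z, q z; u21 z, w z, 0; 0, q z, -2 * w z]

/-- The component in `𝔤₀` of the `dz`-part. -/
def formB (u11 p : ℂ → ℂ) (z : ℂ) : M3 :=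
  !![u11 z, 0, p z; 0, -u11 z, 0; 0, -p z, 0]

theorem sigma_cube_add (X Y : M3) : sigma^[3] (X + Y) = sigma^[3] X + sigma^[3] Y := by
  rw [sigma_cube, sigma_cube, sigma_cube]
  ext i j
  fin_cases i <;> fin_cases j <;> simp <;> ring

theorem exp_two_pi_div_two : Complex.exp (2 * Real.pi * I / (2 : ℕ)) = -1 := by
  rw [← Complex.exp_pi_mul_I]
  congr 1
  push_cast
  ring

/-- The values 1, -1 and i suffice: the sum of the first two isolates b, and comparison of 1 with i
separates a from c. -/
theorem laurent_eq_zero {V : Type*} [AddCommGroup V] [Module ℂ V] {a b c : V}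
    (h : ∀ l : ℂ, l ≠ 0 → l⁻¹ • a + b + l • c = 0) : a = 0 ∧ b = 0 := by
  have h1 := h 1 one_ne_zero
  have h2 := h (-1) (by norm_num)
  have h3 := h I Complex.I_ne_zero
  simp only [inv_one, one_smul, inv_neg, neg_smul, Complex.inv_I] at h1 h2 h3
  have hb : b = 0 := by
    have : (2 : ℂ) • b = 0 := by
      have e : (2 : ℂ) • b = (a + b + c) + (-a + b + -c) := by module
      rw [e, h1, h2, add_zero]
    exact (smul_eq_zero.1 this).resolve_left two_ne_zero
  subst hb
  refine ⟨?_, rfl⟩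
  have e : (2 * I) • a = I • (a + 0 + c) - (-(I • a) + 0 + I • c) := by module
  rw [h1, h3, smul_zero, sub_zero] at e
  exact (smul_eq_zero.1 e).resolve_left (by simp)

namespace IsSpecialFrame

variable {D : Set ℂ} {F : ℂ → M3} {u11 w u12 u13 u21 u32 : ℂ → ℂ}

section

variable (h : IsSpecialFrame D F u11 w u12 u13 u21 u32)
include h

/-- σ³ is an involution, so 𝔤₋₁ = 𝔤₁ is its (-1)-eigenspace, and the components are forced to be the
odd and even parts of the form. Integrability is then a Laurent polynomial identity in λ. The
coefficients of λ⁻¹ and λ⁰ are recorded; that of λ is the adjoint of the first. -/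
theorem sigma_cube_equations (hp : IsPrimitiveHarmonic D (sigma^[3]) 2 F) {p q : ℂ → ℂ}
    (hpe : ∀ z, p z = (u13 z - u32 z) / 2) (hqe : ∀ z, q z = (u13 z + u32 z) / 2) :
    ∀ z ∈ D,
      matDzbar (formA w u12 u21 q) z =
        formA w u12 u21 q z * -(formB u11 p z)ᴴ - -(formB u11 p z)ᴴ * formA w u12 u21 q z ∧
      matDzbar (formB u11 p) z - matDz (fun ζ => -(formB u11 p ζ)ᴴ) z =
        (formB u11 p z * -(formB u11 p z)ᴴ - -(formB u11 p z)ᴴ * formB u11 p z) +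
        (formA w u12 u21 q z * -(formA w u12 u21 q z)ᴴ -
          -(formA w u12 u21 q z)ᴴ * formA w u12 u21 q z) := by
  obtain ⟨αm, α0', α0'', αp, h1, h2⟩ := hp
  -- Odd and even parts under σ³ are determined by the sum, which identifies the unknown components
  -- with `formA`, `formB` and their negative adjoints.
  have split (X Y Z : M3) (hX : sigma^[3] X = -X) (hY : sigma^[3] Y = Y) (hZ : Z = X + Y) :
      X = (1 / 2 : ℂ) • (Z - sigma^[3] Z) ∧ Y = (1 / 2 : ℂ) • (Z + sigma^[3] Z) := by
    rw [hZ, sigma_cube_add, hX, hY]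
    constructor <;> module
  have hm : ∀ z ∈ D, αm z = formA w u12 u21 q z ∧ α0' z = formB u11 p z := by
    intro z hz
    obtain ⟨⟨-, hm⟩, ⟨-, h0⟩, -, -, hU, -⟩ := h1 z hz
    rw [exp_two_pi_div_two] at hm h0
    obtain ⟨e1, e2⟩ := split (αm z) (α0' z) (formU u11 w u12 u13 u21 u32 z)
      (by simpa using hm) (by simpa using h0) ((h.inv_dz z hz).symm.trans hU)
    rw [e1, e2, sigma_cube]
    constructor
    · ext i j
      fin_cases i <;> fin_cases j <;> simp [formU, formA, hqe] <;> ring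
    · ext i j
      fin_cases i <;> fin_cases j <;> simp [formU, formB, hpe] <;> ring
  have hpl : ∀ z ∈ D, αp z = -(formA w u12 u21 q z)ᴴ ∧ α0'' z = -(formB u11 p z)ᴴ := by
    intro z hz
    obtain ⟨-, -, ⟨-, h0⟩, ⟨-, hm⟩, -, hV⟩ := h1 z hz
    rw [exp_two_pi_div_two] at hm h0
    obtain ⟨e1, e2⟩ := split (αp z) (α0'' z) (formV u11 w u12 u13 u21 u32 z)
      (by simpa using hm) (by simpa using h0)
      ((h.inv_dzbar z hz).symm.trans (hV.trans (add_comm _ _)))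
    rw [e1, e2, sigma_cube]
    constructor
    · ext i j
      fin_cases i <;> fin_cases j <;> simp [formV, formA, hqe] <;> ring
    · ext i j
      fin_cases i <;> fin_cases j <;> simp [formV, formB, hpe] <;> ring
  intro z hz
  have dif {f : ℂ → ℂ} (hf : ContDiffOn ℝ ∞ f D) : DifferentiableAt ℝ f z :=
    h.differentiableAt_of_smooth hf hz
  have d13 := dif h.smooth_u13
  have d32 := dif h.smooth_u32
  have dp : DifferentiableAt ℝ p z := by
    rw [show p = fun z => (u13 z - u32 z) / 2 from funext hpe]
    fun_prop
  have dq : DifferentiableAt ℝ q z := by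
    rw [show q = fun z => (u13 z + u32 z) / 2 from funext hqe]
    fun_prop
  have d11 := dif h.smooth_u11
  have d12 := dif h.smooth_u12
  have d21 := dif h.smooth_u21
  have dw := dif h.smooth_w
  have dA (i j) : DifferentiableAt ℝ (fun ζ => formA w u12 u21 q ζ i j) z := by
    fin_cases i <;> fin_cases j <;> simp [formA] <;> fun_prop
  have dB (i j) : DifferentiableAt ℝ (fun ζ => formB u11 p ζ i j) z := by
    fin_cases i <;> fin_cases j <;> simp [formB] <;> fun_prop
  have dB' (i j) : DifferentiableAt ℝ (fun ζ => (-(formB u11 p ζ)ᴴ) i j) z := ((dB j i).star).neg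
  have dA' (i j) : DifferentiableAt ℝ (fun ζ => (-(formA w u12 u21 q ζ)ᴴ) i j) z :=
    ((dA j i).star).neg
  have key := laurent_eq_zero (a := matDzbar (formA w u12 u21 q) z -
        (formA w u12 u21 q z * -(formB u11 p z)ᴴ - -(formB u11 p z)ᴴ * formA w u12 u21 q z))
    (b := matDzbar (formB u11 p) z - matDz (fun ζ => -(formB u11 p ζ)ᴴ) z -
        ((formB u11 p z * -(formB u11 p z)ᴴ - -(formB u11 p z)ᴴ * formB u11 p z) +
        (formA w u12 u21 q z * -(formA w u12 u21 q z)ᴴ -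
          -(formA w u12 u21 q z)ᴴ * formA w u12 u21 q z)))
    (c := -matDz (fun ζ => -(formA w u12 u21 q ζ)ᴴ) z - (formB u11 p z * -(formA w u12 u21 q z)ᴴ -
          -(formA w u12 u21 q z)ᴴ * formB u11 p z)) (by
      intro l hl
      have e := formIntegrable_congr h.isOpen
        (A' := fun z => l⁻¹ • formA w u12 u21 q z + formB u11 p z)
        (B' := fun z => -(formB u11 p z)ᴴ + l • -(formA w u12 u21 q z)ᴴ)
        (fun z hz => by rw [(hm z hz).1, (hm z hz).2])
        (fun z hz => by rw [(hpl z hz).1, (hpl z hz).2]) (h2 l hl) z hz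
      have e1 : matDzbar (fun z => l⁻¹ • formA w u12 u21 q z + formB u11 p z) z =
          l⁻¹ • matDzbar (formA w u12 u21 q) z + matDzbar (formB u11 p) z := by
        ext i j
        have hs : DifferentiableAt ℝ (fun ζ => l⁻¹ * formA w u12 u21 q ζ i j) z :=
          (dA i j).const_mul _
        exact (dzbar_add hs (dB i j)).trans (by rw [dzbar_const_mul _ (dA i j)]; rfl)
      have e2 : matDz (fun z => -(formB u11 p z)ᴴ + l • -(formA w u12 u21 q z)ᴴ) z =
          matDz (fun z => -(formB u11 p z)ᴴ) z +
            l • matDz (fun z => -(formA w u12 u21 q z)ᴴ) z := by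
        ext i j
        have hs : DifferentiableAt ℝ (fun ζ => l * (-(formA w u12 u21 q ζ)ᴴ) i j) z :=
          (dA' i j).const_mul _
        exact (dz_add (dB' i j) hs).trans (by rw [dz_const_mul _ (dA' i j)]; rfl)
      rw [e1, e2] at e
      clear e1 e2
      beta_reduce at e
      generalize matDzbar (formA w u12 u21 q) z = X1 at *
      generalize matDzbar (formB u11 p) z = X2 at *
      generalize matDz (fun z => -(formB u11 p z)ᴴ) z = X3 at *
      generalize matDz (fun z => -(formA w u12 u21 q z)ᴴ) z = X4 at *
      generalize -(formB u11 p z)ᴴ = B1 at *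
      generalize -(formA w u12 u21 q z)ᴴ = A1 at *
      generalize formA w u12 u21 q z = A at *
      generalize formB u11 p z = B at *
      have e' := sub_eq_zero.2 e
      rw [← e']
      simp only [add_mul, mul_add, smul_mul_assoc, mul_smul_comm]
      match_scalars <;> field_simp)
  exact ⟨sub_eq_zero.1 key.1, sub_eq_zero.1 key.2⟩

end

end IsSpecialFrame

theorem dz_eq_zero_of_eventually {E : Type*} [NormedAddCommGroup E] [NormedSpace ℂ E]
    {f : ℂ → E} {D : Set ℂ} (hD : IsOpen D) (h : ∀ z ∈ D, f z = 0) {z : ℂ} (hz : z ∈ D) :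
    dz f z = 0 ∧ dzbar f z = 0 := by
  have e : f =ᶠ[𝓝 z] fun _ => 0 := by
    filter_upwards [hD.mem_nhds hz] with ζ hζ using h ζ hζ
  exact ⟨(dz_congr e).trans (dz_const 0 z), (dzbar_congr e).trans (dzbar_const 0 z)⟩

theorem exists_const_of_dz {f : ℂ → ℂ} {D : Set ℂ} (hD : IsOpen D) (hDc : IsPreconnected D)
    (hf : DifferentiableOn ℝ f D) (h : ∀ z ∈ D, dz f z = 0) (h' : ∀ z ∈ D, dzbar f z = 0) :
    ∃ c, ∀ z ∈ D, f z = c :=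
  hD.exists_is_const_of_fderiv_eq_zero hDc hf
    fun z hz => fderiv_eq_zero_of_dz (h z hz) (h' z hz)

namespace IsSpecialFrame

variable {D : Set ℂ} {F : ℂ → M3} {u11 w u12 u13 u21 u32 : ℂ → ℂ}

section

variable (h : IsSpecialFrame D F u11 w u12 u13 u21 u32)
include h

/-- A primitive harmonic frame relative to `σ³` has `u₁₃ = u₃₂`, or `u₁₂ = 0` and
`u₁₃ = -u₃₂`. -/
theorem sigma_cube_dichotomy (hDc : IsPreconnected D)
    (hp : IsPrimitiveHarmonic D (sigma^[3]) 2 F) :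
    (∀ z ∈ D, u13 z = u32 z) ∨ (∀ z ∈ D, u13 z = -u32 z ∧ u12 z = 0) := by
  set p : ℂ → ℂ := fun z => (u13 z - u32 z) / 2 with hpe
  set q : ℂ → ℂ := fun z => (u13 z + u32 z) / 2 with hqe
  have eqs := h.sigma_cube_equations hp (p := p) (q := q) (fun _ => rfl) (fun _ => rfl)
  have pc : ContinuousOn p D := by
    have h1 := h.smooth_u13.continuousOn
    have h2 := h.smooth_u32.continuousOn
    fun_prop
  have qc : ContinuousOn q D := by
    have h1 := h.smooth_u13.continuousOn
    have h2 := h.smooth_u32.continuousOn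
    fun_prop
  -- The entry (1,2) of `formA` is identically zero, so its differential equation is purely
  -- algebraic.
  have ew : ∀ z ∈ D, w z * star (p z) = 0 := by
    intro z hz
    have := congrFun (congrFun (eqs z hz).1 1) 2
    simp only [matDzbar_apply, Matrix.sub_apply, Matrix.mul_apply, Fin.sum_univ_three] at this
    simp [formA, formB] at this
    simp only [Complex.star_def]
    linear_combination (-1 / 3 : ℂ) * this
  have edw : ∀ z ∈ D, dzbar w z = -(q z * star (p z)) := by
    intro z hz
    have := congrFun (congrFun (eqs z hz).1 0) 0
    simp only [matDzbar_apply, Matrix.sub_apply, Matrix.mul_apply, Fin.sum_univ_three] at this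
    simp [formA, formB] at this
    simp only [Complex.star_def]
    linear_combination this
  have edq : ∀ z ∈ D, dzbar q z = u12 z * star (p z) + star (u11 z) * q z := by
    intro z hz
    have := congrFun (congrFun (eqs z hz).1 0) 2
    simp only [matDzbar_apply, Matrix.sub_apply, Matrix.mul_apply, Fin.sum_univ_three] at this
    simp [formA, formB] at this
    simp only [Complex.star_def]
    linear_combination this
  have hU : IsOpen (D ∩ p ⁻¹' {0}ᶜ) :=
    pc.isOpen_inter_preimage h.isOpen isOpen_compl_singleton
  have hV : IsOpen (D ∩ q ⁻¹' {0}ᶜ) :=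
    qc.isOpen_inter_preimage h.isOpen isOpen_compl_singleton
  -- On the open set p ≠ 0 the function w vanishes, hence so does w_z̄ = -q p̄.
  have hpq : ∀ z ∈ D, p z ≠ 0 → q z = 0 := by
    intro z hz hpz
    have h1 : dzbar w z = 0 := by
      refine (dz_eq_zero_of_eventually hU (fun ζ hζ => ?_) (z := z) ⟨hz, hpz⟩).2
      exact (mul_eq_zero.1 (ew ζ hζ.1)).resolve_right (by simpa using hζ.2)
    rw [edw z hz, neg_eq_zero, mul_eq_zero] at h1
    exact h1.resolve_right (by simpa using hpz)
  have hpq' : ∀ z ∈ D, p z ≠ 0 ∨ q z ≠ 0 := by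
    intro z hz
    by_contra! hc
    have : u13 z = p z + q z := by simp only [hpe, hqe]; ring
    exact h.u13_ne z hz (by rw [this, hc.1, hc.2, add_zero])
  -- The sets p ≠ 0 and q ≠ 0 are open, disjoint and cover D, so one of them is all of D.
  rcases isPreconnected_iff_subset_of_disjoint.1 hDc _ _ hU hV
    (fun z hz => (hpq' z hz).imp (fun h1 => ⟨hz, h1⟩) (fun h1 => ⟨hz, h1⟩))
    (by
      ext z
      simp only [Set.mem_inter_iff, Set.mem_empty_iff_false, iff_false]
      rintro ⟨hz, ⟨-, h1⟩, -, h2⟩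
      exact h2 (hpq z hz h1)) with hs | hs
  · right
    have hq0 : ∀ z ∈ D, q z = 0 := fun z hz => hpq z hz (hs hz).2
    intro z hz
    have e0 := hq0 z hz
    have h1 := edq z hz
    rw [(dz_eq_zero_of_eventually h.isOpen hq0 hz).2, e0, mul_zero, add_zero, eq_comm,
      mul_eq_zero] at h1
    refine ⟨?_, h1.resolve_right (by simpa using (hs hz).2)⟩
    simp only [hqe] at e0
    linear_combination 2 * e0
  · left
    intro z hz
    have e0 : p z = 0 := by
      by_contra hne
      exact (hs hz).2 (hpq z hz hne)
    simp only [hpe] at e0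
    linear_combination 2 * e0

/-- The structure equations of a primitive harmonic frame relative to `σ³` with
`u₁₃ = u₃₂`. -/
theorem sigma_cube_lagrangian_equations
    (hp : IsPrimitiveHarmonic D (sigma^[3]) 2 F) (he : ∀ z ∈ D, u13 z = u32 z) :
    ∀ z ∈ D, dzbar w z = 0 ∧ dzbar u12 z = 2 * star (u11 z) * u12 z ∧
      dzbar u21 z = -2 * star (u11 z) * u21 z ∧ dzbar u13 z = star (u11 z) * u13 z ∧
      u12 z * star (u13 z) = 3 * star (w z) * u13 z ∧
      dzbar u11 z + dz (fun ζ => star (u11 ζ)) z =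
        u21 z * star (u21 z) - u12 z * star (u12 z) - u13 z * star (u13 z) := by
  intro z hz
  set p : ℂ → ℂ := fun z => (u13 z - u32 z) / 2 with hpe
  set q : ℂ → ℂ := fun z => (u13 z + u32 z) / 2 with hqe
  obtain ⟨e1, e2⟩ := h.sigma_cube_equations hp (p := p) (q := q) (fun _ => rfl) (fun _ => rfl) z hz
  have hp0 : ∀ z ∈ D, p z = 0 := fun z hz => by simp [hpe, he z hz]
  have hq0 : ∀ z ∈ D, q z = u13 z := fun z hz => by simp only [hqe, he z hz]; ring
  have hqd : dzbar q z = dzbar u13 z :=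
    dzbar_congr (by filter_upwards [h.isOpen.mem_nhds hz] with ζ hζ using hq0 ζ hζ)
  have e00 := congrFun (congrFun e1 0) 0
  have e01 := congrFun (congrFun e1 0) 1
  have e10 := congrFun (congrFun e1 1) 0
  have e02 := congrFun (congrFun e1 0) 2
  have f00 := congrFun (congrFun e2 0) 0
  have f02 := congrFun (congrFun e2 0) 2
  simp only [matDzbar_apply, matDz_apply, Matrix.sub_apply, Matrix.add_apply, Matrix.mul_apply,
    Fin.sum_univ_three] at e00 e01 e10 e02 f00 f02
  have pd := (dz_eq_zero_of_eventually h.isOpen hp0 hz).2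
  simp [formA, formB, hp0 z hz, hq0 z hz, hqd] at e00 e01 e10 e02 f00 f02
  simp only [Complex.star_def]
  rw [dz_neg] at f00
  refine ⟨by linear_combination e00, by linear_combination e01, by linear_combination e10, by linear_combination e02, ?_,
    by linear_combination f00⟩
  rw [pd] at f02
  linear_combination f02

end

end IsSpecialFrame

/-! ### Integration of the scalar structure equations -/

/-- The scalar structure equations of the Lagrangian frames that are primitive harmonic relative
to `σ³`. -/
structure LagrangianSystem (D : Set ℂ) (u11 w u12 u21 q : ℂ → ℂ) : Prop where
  isOpen : IsOpen D
  conn : IsPreconnected D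
  smooth_u11 : ContDiffOn ℝ ∞ u11 D
  smooth_w : ContDiffOn ℝ ∞ w D
  smooth_u12 : ContDiffOn ℝ ∞ u12 D
  smooth_u21 : ContDiffOn ℝ ∞ u21 D
  smooth_q : ContDiffOn ℝ ∞ q D
  q_ne : ∀ z ∈ D, q z ≠ 0
  dzbar_w : ∀ z ∈ D, dzbar w z = 0
  dzbar_u12 : ∀ z ∈ D, dzbar u12 z = 2 * star (u11 z) * u12 z
  dzbar_u21 : ∀ z ∈ D, dzbar u21 z = -2 * star (u11 z) * u21 z
  dzbar_q : ∀ z ∈ D, dzbar q z = star (u11 z) * q z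
  u12_q : ∀ z ∈ D, u12 z * star (q z) = 3 * star (w z) * q z
  gauss : ∀ z ∈ D, dzbar u11 z + dz (fun ζ => star (u11 ζ)) z =
    u21 z * star (u21 z) - u12 z * star (u12 z) - q z * star (q z)

namespace LagrangianSystem

variable {D : Set ℂ} {u11 w u12 u21 q : ℂ → ℂ} {z : ℂ}

theorem differentiableAt (h : LagrangianSystem D u11 w u12 u21 q) {f : ℂ → ℂ}
    (hf : ContDiffOn ℝ ∞ f D) (hz : z ∈ D) : DifferentiableAt ℝ f z :=
  (hf.contDiffAt (h.isOpen.mem_nhds hz)).differentiableAt (by simp)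

section

variable (h : LagrangianSystem D u11 w u12 u21 q)
include h

theorem star_q_ne (hz : z ∈ D) : star (q z) ≠ 0 := star_ne_zero.2 (h.q_ne z hz)

/-- The z̄-derivatives of u₁₂ and q² have the same logarithmic factor 2ū₁₁, so w u₁₂/q² is
holomorphic. By the relation `u12_q` it equals 3|w|²/|q|², which is real; a real holomorphic
function on a connected set is constant. -/
theorem exists_const_u12 : ∃ c : ℂ, ∀ z ∈ D, w z * u12 z = c * q z ^ 2 ∧
    c * (q z * star (q z)) = 3 * (w z * star (w z)) := by
  set k : ℂ → ℂ := fun z => w z * (u12 z * ((q z)⁻¹ * (q z)⁻¹)) with hk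
  have hreal : ∀ z ∈ D, k z * (q z * star (q z)) = 3 * (w z * star (w z)) := by
    intro z hz
    have h1 := h.u12_q z hz
    have h2 := h.q_ne z hz
    simp only [hk]
    field_simp
    linear_combination w z * h1
  have hkd : ∀ z ∈ D, DifferentiableAt ℝ k z := fun z hz => by
    have h1 := h.differentiableAt h.smooth_w hz
    have h2 := h.differentiableAt h.smooth_u12 hz
    have h3 : DifferentiableAt ℝ (fun z => (q z)⁻¹) z :=
      (h.differentiableAt h.smooth_q hz).inv (h.q_ne z hz)
    exact h1.mul (h2.mul (h3.mul h3))
  have hbar : ∀ z ∈ D, dzbar k z = 0 := by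
    intro z hz
    have h1 := h.differentiableAt h.smooth_w hz
    have h2 := h.differentiableAt h.smooth_u12 hz
    have h3 : DifferentiableAt ℝ (fun z => (q z)⁻¹) z :=
      (h.differentiableAt h.smooth_q hz).inv (h.q_ne z hz)
    have h4 := h.q_ne z hz
    have h5 : DifferentiableAt ℝ (fun z => (q z)⁻¹ * (q z)⁻¹) z := h3.mul h3
    have h6 : DifferentiableAt ℝ (fun z => u12 z * ((q z)⁻¹ * (q z)⁻¹)) z := h2.mul h5
    simp only [hk]
    rw [dzbar_mul h1 h6, dzbar_mul h2 h5, dzbar_mul h3 h3,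
      dzbar_inv (h.differentiableAt h.smooth_q hz) h4, h.dzbar_w z hz, h.dzbar_u12 z hz,
      h.dzbar_q z hz]
    field_simp
    ring
  have hself : ∀ z ∈ D, star (k z) = k z := by
    intro z hz
    have h1 := hreal z hz
    have h2 := congrArg star h1
    have h3 : q z * star (q z) ≠ 0 := mul_ne_zero (h.q_ne z hz) (h.star_q_ne hz)
    simp only [star_mul', star_star] at h2
    have h30 : star (3 : ℂ) = 3 := by simp
    rw [h30] at h2
    apply mul_right_cancel₀ h3
    rw [h1]
    linear_combination h2
  have hdz : ∀ z ∈ D, dz k z = 0 := by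
    intro z hz
    have e : k =ᶠ[𝓝 z] fun ζ => star (k ζ) := by
      filter_upwards [h.isOpen.mem_nhds hz] with ζ hζ using (hself ζ hζ).symm
    rw [dz_congr e, dz_star, hbar z hz, star_zero]
  obtain ⟨c, hc⟩ := exists_const_of_dz h.isOpen h.conn
    (fun z hz => (hkd z hz).differentiableWithinAt) hdz hbar
  refine ⟨c, fun z hz => ⟨?_, ?_⟩⟩
  · have h4 := h.q_ne z hz
    rw [← hc z hz]
    simp only [hk]
    field_simp
  · rw [← hreal z hz, hc z hz]

section

variable {c : ℂ} (hc : c ≠ 0) (hcw : ∀ z ∈ D, w z * u12 z = c * q z ^ 2 ∧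
    c * (q z * star (q z)) = 3 * (w z * star (w z)))
include hc hcw

theorem w_ne (hz : z ∈ D) : w z ≠ 0 := by
  intro h0
  have h1 := (hcw z hz).2
  rw [h0, zero_mul, mul_zero] at h1
  exact mul_ne_zero hc (mul_ne_zero (h.q_ne z hz) (h.star_q_ne hz)) h1

/-- The system prescribes only z̄-derivatives. The z-derivative of q comes from differentiating
c|q|² = 3|w|², where q̄_z is the conjugate of q_z̄. -/
theorem dz_q (hz : z ∈ D) : w z * dz q z = q z * (dz w z - u11 z * w z) := by
  have hq := h.differentiableAt h.smooth_q hz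
  have hw := h.differentiableAt h.smooth_w hz
  have hq' : DifferentiableAt ℝ (fun ζ => star (q ζ)) z := hq.star
  have hw' : DifferentiableAt ℝ (fun ζ => star (w ζ)) z := hw.star
  have e : dz (fun ζ => c * (q ζ * star (q ζ))) z = dz (fun ζ => 3 * (w ζ * star (w ζ))) z :=
    dz_congr (by filter_upwards [h.isOpen.mem_nhds hz] with ζ hζ using (hcw ζ hζ).2)
  have hqq : DifferentiableAt ℝ (fun ζ => q ζ * star (q ζ)) z := hq.mul hq'
  have hww : DifferentiableAt ℝ (fun ζ => w ζ * star (w ζ)) z := hw.mul hw'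
  rw [dz_const_mul _ hqq, dz_const_mul _ hww, dz_mul hq hq', dz_mul hw hw',
    dz_star, dz_star, h.dzbar_w z hz, h.dzbar_q z hz] at e
  simp only [star_mul', star_star, star_zero] at e
  have hw0 : star (w z) ≠ 0 := star_ne_zero.2 (h.w_ne hc hcw hz)
  have e2 := (hcw z hz).2
  apply mul_left_cancel₀ (mul_ne_zero three_ne_zero hw0)
  linear_combination q z * e - (dz q z + u11 z * q z) * e2

theorem dz_u12 (hz : z ∈ D) : w z * dz u12 z = u12 z * (dz w z - 2 * u11 z * w z) := by
  have hq := h.differentiableAt h.smooth_q hz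
  have hw := h.differentiableAt h.smooth_w hz
  have hu := h.differentiableAt h.smooth_u12 hz
  have e : dz (fun ζ => w ζ * u12 ζ) z = dz (fun ζ => c * (q ζ * q ζ)) z :=
    dz_congr (by
      filter_upwards [h.isOpen.mem_nhds hz] with ζ hζ
      rw [(hcw ζ hζ).1, sq])
  have hqq : DifferentiableAt ℝ (fun ζ => q ζ * q ζ) z := hq.mul hq
  rw [dz_const_mul _ hqq, dz_mul hw hu, dz_mul hq hq] at e
  apply mul_left_cancel₀ (h.w_ne hc hcw hz)
  linear_combination w z * e + 2 * c * q z * h.dz_q hc hcw hz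
    - 2 * (dz w z - u11 z * w z) * (hcw z hz).1

/-- Formally (log q)_z̄ = ū₁₁ and (log q)_z = w_z/w - u₁₁. Equality of the mixed derivatives gives
the claim, because w_z/w is holomorphic. -/
theorem flat (hz : z ∈ D) : dzbar u11 z + dz (fun ζ => star (u11 ζ)) z = 0 := by
  have hs (f : ℂ → ℂ) (hf : ContDiffOn ℝ ∞ f D) := h.differentiableAt hf hz
  have dq := hs _ h.smooth_q
  have dw := hs _ h.smooth_w
  have dqz := hs _ (contDiffOn_dz h.isOpen h.smooth_q)
  have dwz := hs _ (contDiffOn_dz h.isOpen h.smooth_w)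
  have d11 := hs _ h.smooth_u11
  have ds11 : DifferentiableAt ℝ (fun ζ => star (u11 ζ)) z := d11.star
  have e1 : dzbar (fun ζ => w ζ * dz q ζ) z =
      dzbar (fun ζ => q ζ * (dz w ζ + -(u11 ζ * w ζ))) z :=
    dzbar_congr (by
      filter_upwards [h.isOpen.mem_nhds hz] with ζ hζ
      rw [h.dz_q hc hcw hζ, sub_eq_add_neg])
  have e2 : dz (dzbar q) z = dz (fun ζ => star (u11 ζ) * q ζ) z :=
    dz_congr (by filter_upwards [h.isOpen.mem_nhds hz] with ζ hζ using h.dzbar_q ζ hζ)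
  have e3 : dzbar (dz w) z = 0 := by
    rw [← dz_dzbar_comm h.isOpen h.smooth_w hz]
    exact (dz_eq_zero_of_eventually h.isOpen h.dzbar_w hz).1
  have duw : DifferentiableAt ℝ (fun ζ => u11 ζ * w ζ) z := d11.mul dw
  have dn : DifferentiableAt ℝ (fun ζ => -(u11 ζ * w ζ)) z := duw.neg
  have da : DifferentiableAt ℝ (fun ζ => dz w ζ + -(u11 ζ * w ζ)) z := dwz.add dn
  rw [dzbar_mul dw dqz, dzbar_mul dq da, dzbar_add dwz dn, dzbar_neg, dzbar_mul d11 dw, e3,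
    h.dzbar_w z hz, h.dzbar_q z hz, ← dz_dzbar_comm h.isOpen h.smooth_q hz, e2,
    dz_mul ds11 dq] at e1
  apply mul_left_cancel₀ (mul_ne_zero (h.w_ne hc hcw hz) (h.q_ne z hz))
  linear_combination e1 - star (u11 z) * h.dz_q hc hcw hz

theorem norm_u21 (hz : z ∈ D) :
    u21 z * star (u21 z) = u12 z * star (u12 z) + q z * star (q z) := by
  have := h.gauss z hz
  rw [h.flat hc hcw hz] at this
  linear_combination -this

theorem u21_ne (hz : z ∈ D) : u21 z ≠ 0 := by
  intro h0
  have h1 := h.norm_u21 hc hcw hz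
  have h2 := norm_pos_iff.2 (h.q_ne z hz)
  simp only [h0, zero_mul, Complex.star_def, Complex.mul_conj'] at h1
  have h3 : ‖u12 z‖ ^ 2 + ‖q z‖ ^ 2 = 0 := by exact_mod_cast h1.symm
  nlinarith [norm_nonneg (u12 z)]

theorem norm_u21_eq (hz : z ∈ D) :
    u21 z * star (u21 z) * c = (9 * c + 3) * (w z * star (w z)) := by
  have h1 := h.u12_q z hz
  have h2 := congrArg star h1
  simp only [star_mul', star_star] at h2
  rw [show star (3 : ℂ) = 3 by simp] at h2
  have hq := h.q_ne z hz
  have hq' := h.star_q_ne hz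
  have h3 : u12 z * star (u12 z) = 9 * (w z * star (w z)) := by
    apply mul_left_cancel₀ (mul_ne_zero hq hq')
    linear_combination star (u12 z) * q z * h1 + 3 * star (w z) * q z * h2
  rw [h.norm_u21 hc hcw hz, h3]
  linear_combination (hcw z hz).2

/-- The quotient u₂₁q²/w³ is holomorphic, since the factors ∓2ū₁₁ cancel, and its modulus is
constant because |u₂₁|², |q|² and |w|² are proportional. -/
theorem exists_const_u21 : ∃ K : ℂ, ∀ z ∈ D, u21 z * q z ^ 2 = K * w z ^ 3 := by
  set k : ℂ → ℂ := fun z => u21 z * ((q z * q z) * ((w z)⁻¹ * ((w z)⁻¹ * (w z)⁻¹))) with hk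
  have hw3 : ∀ z ∈ D, DifferentiableAt ℝ (fun z => (w z)⁻¹) z := fun z hz =>
    (h.differentiableAt h.smooth_w hz).inv (h.w_ne hc hcw hz)
  have hkd : ∀ z ∈ D, DifferentiableAt ℝ k z := fun z hz => by
    have h1 := h.differentiableAt h.smooth_q hz
    have h2 := h.differentiableAt h.smooth_u21 hz
    have h3 := hw3 z hz
    exact h2.mul ((h1.mul h1).mul (h3.mul (h3.mul h3)))
  have hbar : ∀ z ∈ D, dzbar k z = 0 := by
    intro z hz
    have h1 := h.differentiableAt h.smooth_q hz
    have h2 := h.differentiableAt h.smooth_u21 hz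
    have h3 := hw3 z hz
    have h4 := h.w_ne hc hcw hz
    have h5 : DifferentiableAt ℝ (fun z => (w z)⁻¹ * (w z)⁻¹) z := h3.mul h3
    have h6 : DifferentiableAt ℝ (fun z => (w z)⁻¹ * ((w z)⁻¹ * (w z)⁻¹)) z := h3.mul h5
    have h7 : DifferentiableAt ℝ (fun z => q z * q z) z := h1.mul h1
    have h8 : DifferentiableAt ℝ (fun z => (q z * q z) * ((w z)⁻¹ * ((w z)⁻¹ * (w z)⁻¹))) z :=
      h7.mul h6
    simp only [hk]
    rw [dzbar_mul h2 h8, dzbar_mul h7 h6, dzbar_mul h1 h1, dzbar_mul h3 h5, dzbar_mul h3 h3,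
      dzbar_inv (h.differentiableAt h.smooth_w hz) h4, h.dzbar_w z hz, h.dzbar_u21 z hz,
      h.dzbar_q z hz]
    ring
  -- This is |u₂₁|²|q|⁴/|w|⁶ with |u₂₁|² = (9c + 3)|w|²/c and |q|² = 3|w|²/c.
  have hmod : ∀ z ∈ D, k z * star (k z) = (9 * c + 3) * 9 / c ^ 3 := by
    intro z hz
    have h4 := h.w_ne hc hcw hz
    have h4' : star (w z) ≠ 0 := star_ne_zero.2 h4
    have h1 := h.norm_u21_eq hc hcw hz
    have h2 := (hcw z hz).2
    simp only [hk, star_mul', star_inv₀]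
    field_simp
    have h3 : (c * (q z * star (q z))) ^ 2 = (3 * (w z * star (w z))) ^ 2 := by rw [h2]
    linear_combination (c ^ 2 * q z ^ 2 * star (q z) ^ 2) * h1 +
      (9 * c + 3) * (w z * star (w z)) * h3
  have hk0 : ∀ z ∈ D, k z ≠ 0 := by
    intro z hz
    have h1 := h.w_ne hc hcw hz
    have h2 := h.u21_ne hc hcw hz
    have h3 := h.q_ne z hz
    simp only [hk]
    positivity
  have hdz : ∀ z ∈ D, dz k z = 0 := by
    intro z hz
    have hkd' : DifferentiableAt ℝ (fun ζ => star (k ζ)) z := (hkd z hz).star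
    have e : dz (fun ζ => k ζ * star (k ζ)) z = 0 := by
      rw [dz_congr (g := fun _ => (9 * c + 3) * 9 / c ^ 3), dz_const]
      filter_upwards [h.isOpen.mem_nhds hz] with ζ hζ using hmod ζ hζ
    rw [dz_mul (hkd z hz) hkd', dz_star, hbar z hz, star_zero, mul_zero, add_zero] at e
    exact (mul_eq_zero.1 e).resolve_right (star_ne_zero.2 (hk0 z hz))
  obtain ⟨K, hK⟩ := exists_const_of_dz h.isOpen h.conn
    (fun z hz => (hkd z hz).differentiableWithinAt) hdz hbar
  refine ⟨K, fun z hz => ?_⟩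
  have h4 := h.w_ne hc hcw hz
  rw [← hK z hz]
  simp only [hk]
  field_simp

theorem dz_u21 (hz : z ∈ D) : w z * dz u21 z = u21 z * (dz w z + 2 * u11 z * w z) := by
  obtain ⟨K, hK⟩ := h.exists_const_u21 hc hcw
  have hq := h.differentiableAt h.smooth_q hz
  have hw := h.differentiableAt h.smooth_w hz
  have hu := h.differentiableAt h.smooth_u21 hz
  have hww : DifferentiableAt ℝ (fun ζ => w ζ * w ζ) z := hw.mul hw
  have e : dz (fun ζ => u21 ζ * (q ζ * q ζ)) z = dz (fun ζ => K * (w ζ * (w ζ * w ζ))) z :=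
    dz_congr (by
      filter_upwards [h.isOpen.mem_nhds hz] with ζ hζ
      linear_combination hK ζ hζ)
  have hqq : DifferentiableAt ℝ (fun ζ => q ζ * q ζ) z := hq.mul hq
  have hwww : DifferentiableAt ℝ (fun ζ => w ζ * (w ζ * w ζ)) z := hw.mul hww
  rw [dz_const_mul _ hwww, dz_mul hu hqq, dz_mul hq hq, dz_mul hw hww,
    dz_mul hw hw] at e
  apply mul_left_cancel₀ (pow_ne_zero 2 (h.q_ne z hz))
  linear_combination w z * e - 2 * u21 z * q z * h.dz_q hc hcw hz - 3 * dz w z * hK z hz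

end

end

end LagrangianSystem

/-! ### Holomorphic functions and matrix exponentials -/

theorem differentiableAt_complex_of_dzbar {f : ℂ → ℂ} {z : ℂ} (hf : DifferentiableAt ℝ f z)
    (h : dzbar f z = 0) : DifferentiableAt ℂ f z := by
  have e : fderiv ℝ f z = ((ContinuousLinearMap.toSpanSingleton ℂ (dz f z)).restrictScalars ℝ) := by
    ext v
    · simp [fderiv_eq_dz_add_dzbar f z, h]
  have h1 : HasFDerivAt f (ContinuousLinearMap.toSpanSingleton ℂ (dz f z)) z :=
    hasFDerivAt_of_restrictScalars ℝ hf.hasFDerivAt e.symm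
  exact h1.differentiableAt

theorem dz_of_hasDerivAt {f : ℂ → ℂ} {f' z : ℂ} (h : HasDerivAt f f' z) :
    dz f z = f' ∧ dzbar f z = 0 := by
  have h1 : fderiv ℝ f z = (ContinuousLinearMap.toSpanSingleton ℂ f').restrictScalars ℝ :=
    (h.hasFDerivAt.restrictScalars ℝ).fderiv
  have hI : I * (I * f') = -f' := by rw [← mul_assoc, Complex.I_mul_I]; ring
  constructor
  · rw [dz, h1]
    simp [hI]
    ring
  · rw [dzbar, h1]
    simp [hI]

theorem hasDerivAt_exp_smul_entry (M : M3) {W : ℂ → ℂ} {w z : ℂ} (hW : HasDerivAt W w z)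
    (i j : Fin 3) :
    HasDerivAt (fun ζ => NormedSpace.exp (W ζ • M) i j)
      ((w • (NormedSpace.exp (W z • M) * M)) i j) z := by
  open scoped Matrix.Norms.L2Operator in
  have h1 : HasDerivAt (fun t : ℂ => NormedSpace.exp (t • M)) (NormedSpace.exp (W z • M) * M)
      (W z) := hasDerivAt_exp_smul_const M (W z)
  open scoped Matrix.Norms.L2Operator in
  have h2 : HasDerivAt (fun ζ => NormedSpace.exp (W ζ • M))
      (w • (NormedSpace.exp (W z • M) * M)) z := h1.scomp z hW
  open scoped Matrix.Norms.L2Operator in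
  let L : M3 →L[ℂ] ℂ := LinearMap.toContinuousLinearMap (Matrix.entryLinearMap ℂ ℂ i j)
  open scoped Matrix.Norms.L2Operator in
  exact L.hasFDerivAt.comp_hasDerivAt z h2

theorem matDz_exp_smul (M : M3) {W : ℂ → ℂ} {w z : ℂ} (hW : HasDerivAt W w z) :
    matDz (fun ζ => NormedSpace.exp (W ζ • M)) z = w • (NormedSpace.exp (W z • M) * M) ∧
      matDzbar (fun ζ => NormedSpace.exp (W ζ • M)) z = 0 := by
  constructor
  · ext i j
    exact (dz_of_hasDerivAt (hasDerivAt_exp_smul_entry M hW i j)).1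
  · ext i j
    exact (dz_of_hasDerivAt (hasDerivAt_exp_smul_entry M hW i j)).2

/-- Unitary matrices near the identity have small skew-Hermitian logarithms, which commute with
all the matrices that commute with the given one. -/
theorem exists_skew_log (N : Set M3) (hN : N ∈ 𝓝 (0 : M3)) :
    ∀ᶠ A in 𝓝 (1 : M3), A ∈ Matrix.unitaryGroup (Fin 3) ℂ →
      ∃ B ∈ N, Bᴴ = -B ∧ NormedSpace.exp B = A ∧ ∀ X : M3, A * X = X * A → B * X = X * B := by
  open scoped Matrix.Norms.L2Operator in
  obtain ⟨δ, hδ, hball⟩ := Metric.mem_nhds_iff.1 (show N ∈ 𝓝 (0 : M3) from hN)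
  open scoped Matrix.Norms.L2Operator in
  -- For unitary A with ‖A - 1‖ < 2 this arccosine is the norm of the self-adjoint argument of A, so
  -- its smallness puts the logarithm in N.
  have hc : Filter.Tendsto (fun A : M3 => Real.arccos (1 - ‖A - 1‖ ^ 2 / 2)) (𝓝 1) (𝓝 0) := by
    have h1 : Continuous (fun A : M3 => Real.arccos (1 - ‖A - 1‖ ^ 2 / 2)) := by fun_prop
    have := h1.tendsto 1
    simpa using this
  open scoped Matrix.Norms.L2Operator in
  have hev : ∀ᶠ A in 𝓝 (1 : M3), ‖A - 1‖ < 2 := by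
    have h1 : Continuous (fun A : M3 => ‖A - 1‖) := by fun_prop
    exact (h1.tendsto 1).eventually_lt_const (by simp)
  open scoped Matrix.Norms.L2Operator in
  have key : ∀ A : M3, Real.arccos (1 - ‖A - 1‖ ^ 2 / 2) < δ → ‖A - 1‖ < 2 →
      A ∈ Matrix.unitaryGroup (Fin 3) ℂ →
      ∃ B ∈ N, Bᴴ = -B ∧ NormedSpace.exp B = A ∧
        ∀ X : M3, A * X = X * A → B * X = X * B := by
    intro A h1 h2 hA
    let _ : CStarAlgebra M3 := { }
    let u : unitary M3 := ⟨A, hA⟩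
    refine ⟨I • (Unitary.argSelfAdjoint u : M3), hball ?_, ?_, ?_, ?_⟩
    · rw [mem_ball_zero_iff, norm_smul, Complex.norm_I, one_mul]
      have := Unitary.norm_argSelfAdjoint (u := u) h2
      exact lt_of_eq_of_lt this h1
    · have h3 : (Unitary.argSelfAdjoint u : M3)ᴴ = (Unitary.argSelfAdjoint u : M3) :=
        (Unitary.argSelfAdjoint u).2
      rw [Matrix.conjTranspose_smul, h3]
      simp
    · have h3 := congrArg Subtype.val (expUnitary_argSelfAdjoint (u := u) h2)
      rwa [selfAdjoint.expUnitary_coe] at h3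
    · intro X hX
      have hA1 : star A * A = 1 := Matrix.mem_unitaryGroup_iff'.1 hA
      have hA2 : A * star A = 1 := Matrix.mem_unitaryGroup_iff.1 hA
      have hX' : star A * X = X * star A := by
        calc star A * X = star A * (X * A) * star A := by
              rw [mul_assoc, mul_assoc, hA2, mul_one]
          _ = X * star A := by rw [← hX, ← mul_assoc, hA1, one_mul]
      -- The argument is a continuous function of A, so it commutes with whatever commutes with A
      -- and A*.
      have h3 : Commute (Unitary.argSelfAdjoint u : M3) X := by
        rw [Unitary.argSelfAdjoint_coe]
        exact Commute.cfc (a := A) hX hX' _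
      rw [smul_mul_assoc, mul_smul_comm, h3.eq]
  have hlt : ∀ᶠ A in 𝓝 (1 : M3), _ := hc.eventually_lt_const hδ
  filter_upwards [hlt, hev] with A h1 h2 using key A h1 h2

/-- The skew-Hermitian matrices that commute with a normal matrix for which `e₃` is cyclic. -/
theorem eq_of_commute_cyclic {a b r : ℂ} (hr : r ≠ 0) (hb : b ≠ 0) {A X : M3}
    (hA : A = !![1, a, r; b, 1, 0; 0, r, -2]) (hn : A * Aᴴ = Aᴴ * A) (hX : X * A = A * X)
    (hs : Xᴴ = -X) :
    ∃ τ : ℝ, X = (X 0 2 / r) • A - star (X 0 2 / r) • Aᴴ + ((τ : ℂ) * I) • (1 : M3) := by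
  have hr' : star r ≠ 0 := star_ne_zero.2 hr
  set α := X 0 2 / r with hα
  set β := X 1 2 / star r with hβ
  set γ := X 2 2 + 2 * α + 2 * β with hγ
  -- The coefficients α, β, γ are those that match the third columns. The difference Y thus kills e₃
  -- and commutes with A, so it kills Ae₃ and A²e₃; as r and b are nonzero, these together with e₃
  -- span ℂ³.
  have hY : X = α • A + β • Aᴴ + γ • (1 : M3) := by
    rw [← sub_eq_zero]
    set Y := X - (α • A + β • Aᴴ + γ • (1 : M3)) with hYd
    have hYA : Y * A = A * Y := by
      rw [hYd, sub_mul, mul_sub, hX]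
      simp only [add_mul, mul_add, smul_mul_assoc, mul_smul_comm, hn, one_mul, mul_one]
    have y2 (i : Fin 3) : Y i 2 = 0 := by
      rw [hYd, hA]
      fin_cases i
      · simp [hα, hr]
      · simp [hβ, show (starRingEnd ℂ) r ≠ 0 from hr']
      · simp [hγ]
        ring
    have y0 (i : Fin 3) : Y i 0 = 0 := by
      have := congrFun (congrFun hYA i) 2
      simp only [Matrix.mul_apply, Fin.sum_univ_three, y2, mul_zero, zero_mul, add_zero] at this
      rw [hA] at this
      simpa [hr] using this
    have y1 (i : Fin 3) : Y i 1 = 0 := by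
      have := congrFun (congrFun hYA i) 0
      simp only [Matrix.mul_apply, Fin.sum_univ_three, y0, y2, mul_zero, zero_mul, add_zero,
        zero_add] at this
      rw [hA] at this
      simpa [hb] using this
    ext i j
    fin_cases j
    · exact y0 i
    · exact y1 i
    · exact y2 i
  have hβα : β = -star α := by
    have h1 := congrFun (congrFun hs 2) 0
    have h2 := congrFun (congrFun hY 2) 0
    have h3 : X 2 0 = β * star r := by
      rw [h2, hA]
      simp
    rw [Matrix.conjTranspose_apply, Matrix.neg_apply, h3] at h1
    have h4 : X 0 2 = α * r := by rw [hα, div_mul_cancel₀ _ hr]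
    rw [h4, star_mul'] at h1
    apply mul_right_cancel₀ hr'
    linear_combination h1
  have hγ' : star γ = -γ := by
    have h1 := congrFun (congrFun hs 2) 2
    rw [Matrix.conjTranspose_apply, Matrix.neg_apply] at h1
    rw [hγ, hβα]
    simp only [star_add, star_mul', star_neg, star_star, h1]
    simp
    ring
  refine ⟨γ.im, ?_⟩
  have hγ2 : γ = (γ.im : ℂ) * I := by
    have h1 := congrArg Complex.re hγ'
    simp only [Complex.star_def, Complex.conj_re, Complex.neg_re] at h1
    apply Complex.ext <;> simp
    linarith
  rw [← hγ2]
  conv_lhs => rw [hY, hβα]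
  module

/-! ### The flat homogeneous frames -/

namespace LagrangianSystem

variable {D : Set ℂ} {u11 w u12 u21 q : ℂ → ℂ} {z : ℂ}

section

variable (h : LagrangianSystem D u11 w u12 u21 q) {c : ℂ} (hc : c ≠ 0)
  (hcw : ∀ z ∈ D, w z * u12 z = c * q z ^ 2 ∧ c * (q z * star (q z)) = 3 * (w z * star (w z)))
include h hc hcw

theorem dz_inv_mul {f : ℂ → ℂ} (hf : ContDiffOn ℝ ∞ f D) {t : ℂ} (hz : z ∈ D)
    (ht : w z * dz f z = f z * (dz w z + t * w z)) :
    dz (fun ζ => (w ζ)⁻¹ * f ζ) z = t * ((w z)⁻¹ * f z) := by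
  have hw := h.differentiableAt h.smooth_w hz
  have hw0 := h.w_ne hc hcw hz
  have hwi : DifferentiableAt ℝ (fun ζ => (w ζ)⁻¹) z := hw.inv hw0
  rw [dz_mul hwi (h.differentiableAt hf hz), dz_inv hw hw0]
  field_simp
  linear_combination ht

theorem dzbar_inv_mul {f : ℂ → ℂ} (hf : ContDiffOn ℝ ∞ f D) {t : ℂ} (hz : z ∈ D)
    (ht : dzbar f z = t * f z) :
    dzbar (fun ζ => (w ζ)⁻¹ * f ζ) z = t * ((w z)⁻¹ * f z) := by
  have hw := h.differentiableAt h.smooth_w hz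
  have hw0 := h.w_ne hc hcw hz
  have hwi : DifferentiableAt ℝ (fun ζ => (w ζ)⁻¹) z := hw.inv hw0
  rw [dzbar_mul hwi (h.differentiableAt hf hz), dzbar_inv hw hw0, h.dzbar_w z hz, ht]
  ring

/-- The even part is diagonal once p = 0, so the bracket multiplies each entry by a multiple of u₁₁.
After division by w these are exactly the logarithmic z-derivatives of the entries. -/
theorem matDz_formA (hz : z ∈ D) :
    matDz (fun ζ => (w ζ)⁻¹ • formA w u12 u21 q ζ) z =
      ((w z)⁻¹ • formA w u12 u21 q z) * formB u11 (fun _ => 0) z -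
        formB u11 (fun _ => 0) z * ((w z)⁻¹ • formA w u12 u21 q z) := by
  have ew := h.dz_inv_mul hc hcw h.smooth_w hz (t := 0) (by ring)
  have ew2 : dz (fun ζ => (w ζ)⁻¹ * (-2 * w ζ)) z = 0 * ((w z)⁻¹ * (-2 * w z)) :=
    h.dz_inv_mul hc hcw (contDiffOn_const.mul h.smooth_w) hz (t := 0) (by
      rw [dz_const_mul _ (h.differentiableAt h.smooth_w hz)]; ring)
  have e12 := h.dz_inv_mul hc hcw h.smooth_u12 hz (t := -2 * u11 z) (by
    rw [h.dz_u12 hc hcw hz]; ring)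
  have e21 := h.dz_inv_mul hc hcw h.smooth_u21 hz (t := 2 * u11 z) (by
    rw [h.dz_u21 hc hcw hz])
  have eq := h.dz_inv_mul hc hcw h.smooth_q hz (t := -u11 z) (by
    rw [h.dz_q hc hcw hz]; ring)
  ext i j
  rw [matDz_apply]
  simp only [Matrix.sub_apply, Matrix.mul_apply, Fin.sum_univ_three, Matrix.smul_apply,
    smul_eq_mul]
  fin_cases i <;> fin_cases j <;>
    simp only [formA, formB, Matrix.of_apply, Matrix.cons_val', Matrix.cons_val_zero,
      Matrix.cons_val_one, Matrix.cons_val, Fin.zero_eta, Fin.mk_one, Fin.reduceFinMk,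
      ew, ew2, e12, e21, eq, mul_zero, dz_const] <;> ring

theorem matDzbar_formA (hz : z ∈ D) :
    matDzbar (fun ζ => (w ζ)⁻¹ • formA w u12 u21 q ζ) z =
      ((w z)⁻¹ • formA w u12 u21 q z) * -(formB u11 (fun _ => 0) z)ᴴ -
        -(formB u11 (fun _ => 0) z)ᴴ * ((w z)⁻¹ • formA w u12 u21 q z) := by
  have ew := h.dzbar_inv_mul hc hcw h.smooth_w hz (t := 0) (by rw [h.dzbar_w z hz]; ring)
  have ew2 : dzbar (fun ζ => (w ζ)⁻¹ * (-2 * w ζ)) z = 0 * ((w z)⁻¹ * (-2 * w z)) :=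
    h.dzbar_inv_mul hc hcw (contDiffOn_const.mul h.smooth_w) hz (t := 0) (by
      rw [dzbar_const_mul _ (h.differentiableAt h.smooth_w hz), h.dzbar_w z hz]; ring)
  have e12 := h.dzbar_inv_mul hc hcw h.smooth_u12 hz (h.dzbar_u12 z hz)
  have e21 := h.dzbar_inv_mul hc hcw h.smooth_u21 hz (h.dzbar_u21 z hz)
  have eq := h.dzbar_inv_mul hc hcw h.smooth_q hz (h.dzbar_q z hz)
  ext i j
  rw [matDzbar_apply]
  simp only [Matrix.sub_apply, Matrix.mul_apply, Fin.sum_univ_three, Matrix.smul_apply,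
    smul_eq_mul, Matrix.neg_apply, Matrix.conjTranspose_apply]
  fin_cases i <;> fin_cases j <;>
    simp only [formA, formB, Matrix.of_apply, Matrix.cons_val', Matrix.cons_val_zero,
      Matrix.cons_val_one, Matrix.cons_val, Fin.zero_eta, Fin.mk_one, Fin.reduceFinMk,
      ew, ew2, e12, e21, eq, mul_zero, dzbar_const, star_zero, star_neg] <;> ring

/-- The diagonal entries of the identity are the flat Gauss equation `norm_u21`; the entries
coupling the third index to the others are `u12_q` and its conjugate. -/
theorem formA_normal (hz : z ∈ D) :
    formA w u12 u21 q z * (formA w u12 u21 q z)ᴴ =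
      (formA w u12 u21 q z)ᴴ * formA w u12 u21 q z := by
  have h1 := h.norm_u21 hc hcw hz
  have h2 := h.u12_q z hz
  have h3 := congrArg star h2
  simp only [star_mul', star_star] at h3
  rw [show star (3 : ℂ) = 3 by simp] at h3
  simp only [Complex.star_def] at h1 h2 h3
  ext i j
  simp only [Matrix.mul_apply, Fin.sum_univ_three, Matrix.conjTranspose_apply]
  fin_cases i <;> fin_cases j <;> simp [formA]
  · linear_combination -h1
  · ring
  · linear_combination h2
  · ring
  · linear_combination h1
  · linear_combination -h3
  · linear_combination h3
  · linear_combination -h2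
  · ring

/-- Only the function q/w, of constant modulus, varies. Hence the values at two points are conjugate
by a diagonal unitary matrix. -/
theorem formA_eq (hz : z ∈ D) {K : ℂ} (hK : u21 z * q z ^ 2 = K * w z ^ 3) :
    (w z)⁻¹ • formA w u12 u21 q z =
      !![1, c * (q z / w z) ^ 2, q z / w z; K / (q z / w z) ^ 2, 1, 0; 0, q z / w z, -2] := by
  have hw := h.w_ne hc hcw hz
  have hq := h.q_ne z hz
  have e1 : (w z)⁻¹ * u12 z = c * (q z / w z) ^ 2 := by
    field_simp
    linear_combination (hcw z hz).1
  have e2 : (w z)⁻¹ * u21 z = K / (q z / w z) ^ 2 := by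
    field_simp
    linear_combination hK
  ext i j
  fin_cases i <;> fin_cases j <;> simp [formA, hw, e1, e2] <;> field_simp

theorem formU_eq {u32 : ℂ → ℂ} (hz : z ∈ D) (he : q z = u32 z) :
    formU u11 w u12 q u21 u32 z =
    w z • ((w z)⁻¹ • formA w u12 u21 q z) + formB u11 (fun _ => 0) z := by
  rw [smul_inv_smul₀ (h.w_ne hc hcw hz)]
  ext i j
  fin_cases i <;> fin_cases j <;> simp [formU, formA, formB, he] <;> ring

theorem normal_formA (hz : z ∈ D) :
    ((w z)⁻¹ • formA w u12 u21 q z) * ((w z)⁻¹ • formA w u12 u21 q z)ᴴ =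
      ((w z)⁻¹ • formA w u12 u21 q z)ᴴ * ((w z)⁻¹ • formA w u12 u21 q z) := by
  rw [Matrix.conjTranspose_smul]
  simp only [smul_mul_assoc, mul_smul_comm]
  rw [h.formA_normal hc hcw hz, smul_comm]

end

end LagrangianSystem

/-! ### Flatness, and the constant matrix M. -/

namespace IsSpecialFrame

variable {D : Set ℂ} {F : ℂ → M3} {u11 w u12 u13 u21 u32 : ℂ → ℂ} {z : ℂ}

section

variable (h : IsSpecialFrame D F u11 w u12 u13 u21 u32)
  (hL : LagrangianSystem D u11 w u12 u21 u13) (he : ∀ z ∈ D, u13 z = u32 z)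
  {c : ℂ} (hc : c ≠ 0)
  (hcw : ∀ z ∈ D, w z * u12 z = c * u13 z ^ 2 ∧
    c * (u13 z * star (u13 z)) = 3 * (w z * star (w z)))
include h hL he hc hcw

/-- The conformal factor is a constant times |w|² with w holomorphic without zeros, so its logarithm
is harmonic. -/
theorem isFlat {f : ℂ → CP2} (hf : IsLift D (lastCol F) f) : IsFlat D f := by
  refine ⟨lastCol F, hf, h.conformalImmersionOn, fun z hz => ?_⟩
  have hc0 : (0 : ℝ) < ‖c‖ := norm_pos_iff.2 hc
  have hm : ∀ z ∈ D, metric (lastCol F) z 1 1 = 6 / ‖c‖ * ‖w z‖ ^ 2 := by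
    intro z hz
    rw [(h.adaptedAt hz).metric_one, norm_neg, norm_star, ← he z hz]
    have h1 := congrArg norm (hcw z hz).2
    simp only [norm_mul, norm_star] at h1
    rw [show ‖(3 : ℂ)‖ = 3 by simp] at h1
    field_simp
    linear_combination 2 * h1
  have hw : ∀ z ∈ D, DifferentiableAt ℂ w z := fun z hz =>
    differentiableAt_complex_of_dzbar (h.differentiableAt_of_smooth h.smooth_w hz)
      (hL.dzbar_w z hz)
  have hwa : AnalyticAt ℂ w z :=
    DifferentiableOn.analyticAt (fun ζ hζ => (hw ζ hζ).differentiableWithinAt)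
      (h.isOpen.mem_nhds hz)
  have hh : InnerProductSpace.HarmonicAt
      (fun ζ => Real.log (6 / ‖c‖) + (2 : ℝ) • Real.log ‖w ζ‖) z :=
    (InnerProductSpace.harmonicAt_const _).add
      ((hwa.harmonicAt_log_norm (hL.w_ne hc hcw hz)).const_smul (c := (2 : ℝ)))
  have hev : (fun ζ => Real.log (metric (lastCol F) ζ 1 1)) =ᶠ[𝓝 z]
      fun ζ => Real.log (6 / ‖c‖) + (2 : ℝ) • Real.log ‖w ζ‖ := by
    filter_upwards [h.isOpen.mem_nhds hz] with ζ hζ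
    have h1 : ‖w ζ‖ ≠ 0 := norm_ne_zero_iff.2 (hL.w_ne hc hcw hζ)
    rw [hm ζ hζ, Real.log_mul (by positivity) (by positivity), Real.log_pow]
    simp
  have hlap := ((InnerProductSpace.harmonicAt_congr_nhds hev).2 hh).2.eq_of_nhds
  rw [gaussCurvature, hlap]
  simp

/-- With A₀ = A/w the form has parts wA₀ + B and -w̄A₀* - B*. The brackets with B and B* cancel
against the derivatives of A₀; what is left is [A₀, A₀] in z and a multiple of [A₀*, A₀] in z̄,
which is zero by normality. -/
theorem exists_const_conj : ∃ M : M3, ∀ z ∈ D,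
    F z * ((w z)⁻¹ • formA w u12 u21 u13 z) * (F z)ᴴ = M := by
  set A0 : ℂ → M3 := fun z => (w z)⁻¹ • formA w u12 u21 u13 z with hA0
  have dF (z) (hz : z ∈ D) (i j) := h.differentiableAt hz i j
  have dA (z) (hz : z ∈ D) (i j) : DifferentiableAt ℝ (fun ζ => A0 ζ i j) z := by
    have dw := h.differentiableAt_of_smooth h.smooth_w hz
    have d12 := h.differentiableAt_of_smooth h.smooth_u12 hz
    have d21 := h.differentiableAt_of_smooth h.smooth_u21 hz
    have d13 := h.differentiableAt_of_smooth h.smooth_u13 hz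
    have dwi : DifferentiableAt ℝ (fun ζ => (w ζ)⁻¹) z := dw.inv (hL.w_ne hc hcw hz)
    have dA1 : DifferentiableAt ℝ (fun ζ => formA w u12 u21 u13 ζ i j) z := by
      fin_cases i <;> fin_cases j <;> simp [formA] <;> fun_prop
    exact dwi.mul dA1
  have dFH (z) (hz : z ∈ D) (i j) : DifferentiableAt ℝ (fun ζ => (F ζ)ᴴ i j) z := (dF z hz j i).star
  have dFA (z) (hz : z ∈ D) (i j) : DifferentiableAt ℝ (fun ζ => (F ζ * A0 ζ) i j) z := by
    simp only [Matrix.mul_apply, Fin.sum_univ_three]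
    have hd (k) : DifferentiableAt ℝ (fun ζ => F ζ i k * A0 ζ k j) z :=
      (dF z hz i k).mul (dA z hz k j)
    exact ((hd 0).add (hd 1)).add (hd 2)
  have dM (z) (hz : z ∈ D) (i j) :
      DifferentiableAt ℝ (fun ζ => (F ζ * A0 ζ * (F ζ)ᴴ) i j) z := by
    have e : (fun ζ => (F ζ * A0 ζ * (F ζ)ᴴ) i j) =
        fun ζ => (F ζ * A0 ζ) i 0 * (F ζ)ᴴ 0 j + (F ζ * A0 ζ) i 1 * (F ζ)ᴴ 1 j +
          (F ζ * A0 ζ) i 2 * (F ζ)ᴴ 2 j := by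
      funext ζ
      rw [Matrix.mul_apply, Fin.sum_univ_three]
    rw [e]
    have hd (k) : DifferentiableAt ℝ (fun ζ => (F ζ * A0 ζ) i k * (F ζ)ᴴ k j) z :=
      (dFA z hz i k).mul (dFH z hz k j)
    exact ((hd 0).add (hd 1)).add (hd 2)
  have hdz (z) (hz : z ∈ D) : matDz (fun ζ => F ζ * A0 ζ * (F ζ)ᴴ) z = 0 := by
    rw [matDz_mul (dFA z hz) (dFH z hz), matDz_mul (dF z hz) (dA z hz), matDz_conjTranspose,
      h.matDz_eq hz, h.matDzbar_eq hz, hL.matDz_formA hc hcw hz, formV_eq,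
      Matrix.conjTranspose_mul, Matrix.conjTranspose_neg, Matrix.conjTranspose_conjTranspose,
      hL.formU_eq hc hcw hz (he z hz)]
    change (F z * (w z • A0 z + _) * A0 z + F z * (A0 z * _ - _ * A0 z)) * _ +
      F z * A0 z * (-(w z • A0 z + _) * _) = 0
    simp only [mul_add, add_mul, mul_sub, sub_mul, neg_mul, mul_neg, smul_mul_assoc,
      mul_smul_comm, mul_assoc]
    abel
  have hdzbar (z) (hz : z ∈ D) : matDzbar (fun ζ => F ζ * A0 ζ * (F ζ)ᴴ) z = 0 := by
    have hn := hL.normal_formA hc hcw hz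
    rw [matDzbar_mul (dFA z hz) (dFH z hz), matDzbar_mul (dF z hz) (dA z hz),
      matDzbar_conjTranspose,
      h.matDz_eq hz, h.matDzbar_eq hz, hL.matDzbar_formA hc hcw hz, formV_eq,
      Matrix.conjTranspose_mul,
      hL.formU_eq hc hcw hz (he z hz), Matrix.conjTranspose_add, Matrix.conjTranspose_smul]
    change A0 z * (A0 z)ᴴ = (A0 z)ᴴ * A0 z at hn
    change (F z * -(star (w z) • (A0 z)ᴴ + _) * A0 z + F z * (A0 z * -_ - -_ * A0 z)) * _ +
      F z * A0 z * ((star (w z) • (A0 z)ᴴ + _) * _) = 0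
    have hn' (X : M3) : A0 z * ((A0 z)ᴴ * X) = (A0 z)ᴴ * (A0 z * X) := by
      rw [← mul_assoc, hn, mul_assoc]
    simp only [mul_add, add_mul, mul_sub, sub_mul, neg_mul, mul_neg, smul_mul_assoc,
      mul_smul_comm, mul_assoc, neg_add, hn']
    abel
  have hex (i j : Fin 3) : ∃ m : ℂ, ∀ z ∈ D, (F z * A0 z * (F z)ᴴ) i j = m :=
    exists_const_of_dz h.isOpen hL.conn
      (fun z hz => (dM z hz i j).differentiableWithinAt)
      (fun z hz => congrFun (congrFun (hdz z hz) i) j)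
      (fun z hz => congrFun (congrFun (hdzbar z hz) i) j)
  choose m hm using hex
  exact ⟨Matrix.of m, fun z hz => by ext i j; exact hm i j z hz⟩

end

end IsSpecialFrame

/-- The maps `φ` with `φ_z = w M φ` and `φ_z̄ = -w̄ M* φ`, for a normal matrix `M`, are given by
the matrix exponential. -/
theorem eq_exp_mulVec {M : M3} (hn : M * Mᴴ = Mᴴ * M) {B : Set ℂ} (hB : IsOpen B)
    (hBc : IsPreconnected B) {φ : ℂ → C3} {w W : ℂ → ℂ}
    (hφ : ∀ z ∈ B, DifferentiableAt ℝ φ z)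
    (hdz : ∀ z ∈ B, dz φ z = w z • (M *ᵥ φ z))
    (hdzbar : ∀ z ∈ B, dzbar φ z = -star (w z) • (Mᴴ *ᵥ φ z))
    (hW : ∀ z ∈ B, HasDerivAt W (w z) z) {z₀ : ℂ} (hz₀ : z₀ ∈ B) (hW0 : W z₀ = 0) :
    ∀ z ∈ B, φ z = NormedSpace.exp (W z • M - star (W z) • Mᴴ) *ᵥ φ z₀ := by
  -- The product exp(-WM) exp(W̄M*) φ is shown to be constant. The first factor is holomorphic and
  -- the second antiholomorphic, so each derivative meets only one of them; φ is stored as a matrix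
  -- with three equal columns so that the matrix product rule applies.
  set E1 : ℂ → M3 := fun z => NormedSpace.exp (-W z • M) with hE1
  set E2 : ℂ → M3 := fun z => (NormedSpace.exp (W z • M))ᴴ with hE2
  set Φ : ℂ → M3 := fun z => Matrix.of fun i _ => φ z i with hΦ
  have hW' (z) (hz : z ∈ B) : HasDerivAt (fun ζ => -W ζ) (-w z) z := (hW z hz).neg
  have dΦ (z) (hz : z ∈ B) (i j) : DifferentiableAt ℝ (fun ζ => Φ ζ i j) z :=
    differentiableAt_pi.1 (hφ z hz) i
  have d1 (z) (hz : z ∈ B) (i j) : DifferentiableAt ℝ (fun ζ => E1 ζ i j) z :=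
    ((hasDerivAt_exp_smul_entry M (hW' z hz) i j).differentiableAt).restrictScalars ℝ
  have d2 (z) (hz : z ∈ B) (i j) : DifferentiableAt ℝ (fun ζ => E2 ζ i j) z :=
    (((hasDerivAt_exp_smul_entry M (hW z hz) j i).differentiableAt).restrictScalars ℝ).star
  have mulD {F G : ℂ → M3} {z : ℂ} (hF : ∀ i j, DifferentiableAt ℝ (fun ζ => F ζ i j) z)
      (hG : ∀ i j, DifferentiableAt ℝ (fun ζ => G ζ i j) z) (i j) :
      DifferentiableAt ℝ (fun ζ => (F ζ * G ζ) i j) z := by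
    simp only [Matrix.mul_apply, Fin.sum_univ_three]
    have hd (k) : DifferentiableAt ℝ (fun ζ => F ζ i k * G ζ k j) z := (hF i k).mul (hG k j)
    exact ((hd 0).add (hd 1)).add (hd 2)
  have mΦ (z) (hz : z ∈ B) : matDz Φ z = w z • (M * Φ z) := by
    ext i j
    have h1 := congrFun (hdz z hz) i
    rw [dz_apply (hφ z hz)] at h1
    exact h1
  have mΦ' (z) (hz : z ∈ B) : matDzbar Φ z = -star (w z) • (Mᴴ * Φ z) := by
    ext i j
    have h1 := congrFun (hdzbar z hz) i
    rw [dzbar_apply (hφ z hz)] at h1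
    exact h1
  have m1 (z) (hz : z ∈ B) := matDz_exp_smul M (hW' z hz)
  have m2 (z) (hz : z ∈ B) : matDz E2 z = 0 ∧
      matDzbar E2 z = star (w z) • (Mᴴ * E2 z) := by
    obtain ⟨a, b⟩ := matDz_exp_smul M (hW z hz)
    constructor
    · rw [hE2, matDz_conjTranspose, b, Matrix.conjTranspose_zero]
    · rw [hE2, matDzbar_conjTranspose, a, Matrix.conjTranspose_smul, Matrix.conjTranspose_mul]
  have hE2e (z) : E2 z = NormedSpace.exp (star (W z) • Mᴴ) := by
    rw [hE2]
    beta_reduce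
    rw [← Matrix.exp_conjTranspose, Matrix.conjTranspose_smul]
  have c2 (z) : M * E2 z = E2 z * M := by
    rw [hE2e]
    open scoped Matrix.Norms.L2Operator in
    exact ((show Commute M (star (W z) • Mᴴ) from
      (show Commute M Mᴴ from hn).smul_right _).exp_right).eq
  have c2' (z) : Mᴴ * E2 z = E2 z * Mᴴ := by
    rw [hE2e]
    open scoped Matrix.Norms.L2Operator in
    exact ((show Commute Mᴴ (star (W z) • Mᴴ) from (Commute.refl _).smul_right _).exp_right).eq
  have hconst (i j : Fin 3) : ∃ m : ℂ, ∀ z ∈ B, (E1 z * (E2 z * Φ z)) i j = m := by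
    refine exists_const_of_dz hB hBc
      (fun z hz => (mulD (d1 z hz) (mulD (d2 z hz) (dΦ z hz)) i j).differentiableWithinAt)
      (fun z hz => ?_) (fun z hz => ?_)
    · have e : matDz (fun z => E1 z * (E2 z * Φ z)) z = 0 := by
        rw [matDz_mul (d1 z hz) (mulD (d2 z hz) (dΦ z hz)), matDz_mul (d2 z hz) (dΦ z hz),
          (m1 z hz).1, (m2 z hz).1, mΦ z hz]
        change (-w z • (E1 z * M)) * _ + _ = 0
        have c (X : M3) : M * (E2 z * X) = E2 z * (M * X) := by
          rw [← mul_assoc, c2, mul_assoc]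
        simp only [zero_mul, zero_add, smul_mul_assoc, mul_smul_comm, mul_assoc, c]
        rw [neg_smul, neg_add_cancel]
      exact congrFun (congrFun e i) j
    · have e : matDzbar (fun z => E1 z * (E2 z * Φ z)) z = 0 := by
        rw [matDzbar_mul (d1 z hz) (mulD (d2 z hz) (dΦ z hz)), matDzbar_mul (d2 z hz) (dΦ z hz),
          (m1 z hz).2, (m2 z hz).2, mΦ' z hz]
        have c (X : M3) : Mᴴ * (E2 z * X) = E2 z * (Mᴴ * X) := by
          rw [← mul_assoc, c2', mul_assoc]
        simp only [zero_mul, zero_add, smul_mul_assoc, mul_smul_comm, mul_assoc, c]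
        rw [neg_smul, add_neg_cancel, mul_zero]
      exact congrFun (congrFun e i) j
  intro z hz
  have e0 : E1 z₀ * (E2 z₀ * Φ z₀) = Φ z₀ := by
    simp [hE1, hE2, hW0]
  have e1 : E1 z * (E2 z * Φ z) = Φ z₀ := by
    rw [← e0]
    ext i j
    obtain ⟨m, hm⟩ := hconst i j
    rw [hm z hz, hm z₀ hz₀]
  have e2 : NormedSpace.exp (W z • M - star (W z) • Mᴴ) * (E1 z * E2 z) = 1 := by
    have hcm : Commute (W z • M) (star (W z) • Mᴴ) :=
      ((show Commute M Mᴴ from hn).smul_left _).smul_right _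
    have hcomm : Commute (-W z • M) (star (W z) • Mᴴ) :=
      ((show Commute M Mᴴ from hn).smul_left _).smul_right _
    rw [hE2e, hE1]
    beta_reduce
    rw [← Matrix.exp_add_of_commute _ _ hcomm]
    have hneg : -W z • M + star (W z) • Mᴴ = -(W z • M - star (W z) • Mᴴ) := by module
    rw [hneg, ← Matrix.exp_add_of_commute _ _ (Commute.neg_right (Commute.refl (W z • M - star (W z) • Mᴴ))), add_neg_cancel,
      NormedSpace.exp_zero]
  have e3 : Φ z = NormedSpace.exp (W z • M - star (W z) • Mᴴ) * Φ z₀ := by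
    rw [← e1, ← mul_assoc (E1 z), ← mul_assoc, e2, one_mul]
  ext i
  exact congrFun (congrFun e3 i) 0

theorem act_mk {g : Matrix.specialUnitaryGroup (Fin 3) ℂ} {v : C3} (hv : v ≠ 0) {v' : C3}
    (hv' : v' ≠ 0) {a : ℂ} (h : (g : M3) *ᵥ v = a • v') :
    act g (Projectivization.mk ℂ v hv) = Projectivization.mk ℂ v' hv' := by
  rw [act, Projectivization.map_mk, Projectivization.mk_eq_mk_iff']
  exact ⟨a, h.symm⟩

/-- The centralizer in `SU₃` of a matrix. -/
def suCentralizer (M : M3) : Subgroup (Matrix.specialUnitaryGroup (Fin 3) ℂ) where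
  carrier := {g | (g : M3) * M = M * (g : M3)}
  mul_mem' := by
    intro a b ha hb
    change ((a : M3) * (b : M3)) * M = M * ((a : M3) * (b : M3))
    rw [mul_assoc, show (b : M3) * M = M * (b : M3) from hb, ← mul_assoc,
      show (a : M3) * M = M * (a : M3) from ha, mul_assoc]
  one_mem' := by
    change (1 : M3) * M = M * 1
    rw [one_mul, mul_one]
  inv_mem' := by
    intro a ha
    change (a : M3) * M = M * (a : M3) at ha
    have h1 : ((a⁻¹ : Matrix.specialUnitaryGroup (Fin 3) ℂ) : M3) * (a : M3) = 1 :=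
      congrArg Subtype.val (inv_mul_cancel a)
    have h2 : (a : M3) * ((a⁻¹ : Matrix.specialUnitaryGroup (Fin 3) ℂ) : M3) = 1 :=
      congrArg Subtype.val (mul_inv_cancel a)
    change ((a⁻¹ : Matrix.specialUnitaryGroup (Fin 3) ℂ) : M3) * M =
      M * ((a⁻¹ : Matrix.specialUnitaryGroup (Fin 3) ℂ) : M3)
    generalize ((a⁻¹ : Matrix.specialUnitaryGroup (Fin 3) ℂ) : M3) = b at *
    calc b * M = b * (M * (a : M3)) * b := by rw [mul_assoc, mul_assoc, h2, mul_one]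
      _ = M * b := by rw [← ha, ← mul_assoc, h1, one_mul]

theorem isClosed_suCentralizer (M : M3) :
    IsClosed (suCentralizer M : Set (Matrix.specialUnitaryGroup (Fin 3) ℂ)) := by
  refine isClosed_eq ?_ ?_
  · exact continuous_subtype_val.mul continuous_const
  · exact continuous_const.mul continuous_subtype_val

/-! ### Homogeneity under the centralizer of M. -/

namespace IsSpecialFrame

variable {D : Set ℂ} {F : ℂ → M3} {u11 w u12 u13 u21 u32 : ℂ → ℂ} {z : ℂ}

theorem isHomogeneous (h : IsSpecialFrame D F u11 w u12 u13 u21 u32)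
    (hL : LagrangianSystem D u11 w u12 u21 u13) (he : ∀ z ∈ D, u13 z = u32 z)
    {c : ℂ} (hc : c ≠ 0)
    (hcw : ∀ z ∈ D, w z * u12 z = c * u13 z ^ 2 ∧
      c * (u13 z * star (u13 z)) = 3 * (w z * star (w z)))
    {f : ℂ → CP2} (hf : IsLift D (lastCol F) f) : IsHomogeneous D f := by
  refine ⟨⟨lastCol F, hf, h.conformalImmersionOn⟩, ?_⟩
  obtain ⟨M, hM⟩ := h.exists_const_conj hL he hc hcw
  obtain ⟨K, hK⟩ := hL.exists_const_u21 hc hcw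
  have hfm (z) (hz : z ∈ D) : f z = Projectivization.mk ℂ (lastCol F z) (h.lastCol_ne_zero hz) := by
    obtain ⟨h0, hfz⟩ := (hf.2 z hz).2
    exact hfz
  have hr0 (z) (hz : z ∈ D) : u13 z / w z ≠ 0 :=
    div_ne_zero (h.u13_ne z hz) (hL.w_ne hc hcw hz)
  have hnr (z) (hz : z ∈ D) : (u13 z / w z) * star (u13 z / w z) = 3 / c := by
    have h1 := hL.w_ne hc hcw hz
    have h2 : star (w z) ≠ 0 := star_ne_zero.2 h1
    rw [star_div₀]
    field_simp
    linear_combination (hcw z hz).2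
  have hFF (z) (hz : z ∈ D) := h.conjTranspose_mul_self hz
  have hFF' (z) (hz : z ∈ D) := h.mul_conjTranspose_self hz
  refine ⟨suCentralizer M, isClosed_suCentralizer M, ?_, ?_⟩
  · intro p hp q hq
    set r := u13 p / w p with hr
    set r' := u13 q / w q with hr'
    have hrr : r ≠ 0 := hr0 p hp
    have hrr' : r' ≠ 0 := hr0 q hq
    have hd1 : (r' / r) * star (r' / r) = 1 := by
      have h3 : (3 : ℂ) / c ≠ 0 := div_ne_zero three_ne_zero hc
      rw [star_div₀, div_mul_div_comm, hnr p hp, hnr q hq, div_self h3]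
    have hdm : Matrix.diagonal ![r' / r, star (r' / r), 1] ∈
        Matrix.specialUnitaryGroup (Fin 3) ℂ := by
      rw [Matrix.mem_specialUnitaryGroup_iff, Matrix.mem_unitaryGroup_iff]
      constructor
      · rw [Matrix.star_eq_conjTranspose, Matrix.diagonal_conjTranspose, Matrix.diagonal_mul_diagonal,
          ← Matrix.diagonal_one]
        congr 1
        funext i
        fin_cases i
        · exact hd1
        · change star (r' / r) * star (star (r' / r)) = 1
          rw [star_star, mul_comm, hd1]
        · change (1 : ℂ) * star 1 = 1
          simp
      · rw [Matrix.det_diagonal, Fin.prod_univ_three]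
        change r' / r * star (r' / r) * 1 = 1
        rw [hd1, one_mul]
    -- The diagonal factor carries A₀(p) to A₀(q), so this product commutes with M = F A₀ F*; it
    -- fixes e₃, so the product sends φ(p) to φ(q).
    set g : Matrix.specialUnitaryGroup (Fin 3) ℂ :=
      ⟨F q, h.mem q hq⟩ * ⟨_, hdm⟩ * (⟨F p, h.mem p hp⟩)⁻¹ with hg
    have hgc : (g : M3) = F q * Matrix.diagonal ![r' / r, star (r' / r), 1] * (F p)ᴴ := rfl
    refine ⟨g, ?_, ?_⟩
    · change (g : M3) * M = M * (g : M3)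
      have key : Matrix.diagonal ![r' / r, star (r' / r), 1] * ((w p)⁻¹ • formA w u12 u21 u13 p) =
          ((w q)⁻¹ • formA w u12 u21 u13 q) * Matrix.diagonal ![r' / r, star (r' / r), 1] := by
        have hs : star (r' / r) = r / r' := by
          rw [← mul_right_inj' (div_ne_zero hrr' hrr), hd1]
          field_simp
        rw [hL.formA_eq hc hcw hp (hK p hp), hL.formA_eq hc hcw hq (hK q hq), hs, ← hr, ← hr']
        ext i j
        rw [Matrix.diagonal_mul, Matrix.mul_diagonal]
        fin_cases i <;> fin_cases j <;> simp <;> field_simp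
      rw [hgc]
      conv_lhs => rw [← hM p hp]
      conv_rhs => rw [← hM q hq]
      calc _ = F q * (Matrix.diagonal ![r' / r, star (r' / r), 1] * (((F p)ᴴ * F p) *
            ((w p)⁻¹ • formA w u12 u21 u13 p))) * (F p)ᴴ := by simp only [mul_assoc]
        _ = F q * ((w q)⁻¹ • formA w u12 u21 u13 q) * ((F q)ᴴ * F q) *
            Matrix.diagonal ![r' / r, star (r' / r), 1] * (F p)ᴴ := by
          rw [hFF p hp, hFF q hq, one_mul, mul_one, key, mul_assoc, mul_assoc, mul_assoc,
            mul_assoc]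
        _ = _ := by simp only [mul_assoc]
    · rw [hfm p hp, hfm q hq]
      refine (act_mk _ _ (a := 1) ?_).symm
      rw [hgc, lastCol, lastCol, Matrix.mulVec_mulVec, mul_assoc, hFF p hp, mul_one, one_smul,
        ← Matrix.mulVec_mulVec]
      congr 1
      funext i
      rw [Matrix.mulVec_diagonal]
      fin_cases i <;> simp
  · intro p hp
    obtain ⟨ρ, hρ, hball⟩ := Metric.isOpen_iff.1 h.isOpen p hp
    have hw (z) (hz : z ∈ D) : DifferentiableAt ℂ w z :=
      differentiableAt_complex_of_dzbar (h.differentiableAt_of_smooth h.smooth_w hz)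
        (hL.dzbar_w z hz)
    -- A holomorphic primitive of w on a ball around p, normalized by W(p) = 0; the surface is the
    -- orbit map of exp(WM - W̄M*) there.
    obtain ⟨W, hW0, hW⟩ := (DifferentiableOn.isExactOn_ball (c := p) (r := ρ) (f := w)
      fun z hz => (hw z (hball hz)).differentiableWithinAt).with_val_at p 0
    have hnM : M * Mᴴ = Mᴴ * M := by
      have hn := hL.normal_formA hc hcw hp
      rw [← hM p hp]
      set A := (w p)⁻¹ • formA w u12 u21 u13 p
      simp only [Matrix.conjTranspose_mul, Matrix.conjTranspose_conjTranspose]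
      calc _ = F p * (A * ((F p)ᴴ * F p) * Aᴴ) * (F p)ᴴ := by simp only [mul_assoc]
        _ = F p * (Aᴴ * ((F p)ᴴ * F p) * A) * (F p)ᴴ := by
          rw [hFF p hp, mul_one, mul_one, hn]
        _ = _ := by simp only [mul_assoc]
    have hMF (z) (hz : z ∈ D) : M * F z = F z * ((w z)⁻¹ • formA w u12 u21 u13 z) := by
      rw [← hM z hz, mul_assoc, hFF z hz, mul_one]
    have hMF' (z) (hz : z ∈ D) : Mᴴ * F z = F z * ((w z)⁻¹ • formA w u12 u21 u13 z)ᴴ := by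
      rw [← hM z hz]
      simp only [Matrix.conjTranspose_mul, Matrix.conjTranspose_conjTranspose]
      rw [mul_assoc, mul_assoc, hFF z hz, mul_one]
    have hφd (z) (hz : z ∈ D) : DifferentiableAt ℝ (lastCol F) z :=
      (h.smooth_lastCol.contDiffAt (h.isOpen.mem_nhds hz)).differentiableAt (by simp)
    have hflow := eq_exp_mulVec hnM Metric.isOpen_ball (convex_ball p ρ).isPreconnected
      (φ := lastCol F) (w := w) (W := W) (fun z hz => hφd z (hball hz))
      (fun z hz => by
        have hz := hball hz
        have hw0 := hL.w_ne hc hcw hz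
        rw [lastCol, Matrix.mulVec_mulVec, hMF z hz, ← Matrix.mulVec_mulVec, ← Matrix.mulVec_smul,
          h.dz_lastCol hz]
        ext i
        simp [lastCol_eq, formA, Matrix.mulVec, dotProduct, Fin.sum_univ_three]
        field_simp
        ring)
      (fun z hz => by
        have hz := hball hz
        have hw0 := hL.w_ne hc hcw hz
        have hw1 : (starRingEnd ℂ) (w z) ≠ 0 := star_ne_zero.2 hw0
        rw [lastCol, Matrix.mulVec_mulVec, hMF' z hz, ← Matrix.mulVec_mulVec,
          ← Matrix.mulVec_smul, h.dzbar_lastCol hz, ← he z hz]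
        have h2 : (starRingEnd ℂ) 2 = 2 := map_ofNat _ 2
        ext i
        simp [lastCol_eq, formA, Matrix.mulVec, dotProduct, Fin.sum_univ_three]
        field_simp
        simp only [h2]
        ring)
      hW (Metric.mem_ball_self hρ) hW0
    -- W is open at p because W'(p) = w(p) ≠ 0, so every small parameter of the flow is attained by
    -- a point of the ball.
    have hopen : W '' Metric.ball p ρ ∈ 𝓝 (0 : ℂ) := by
      have hWa : AnalyticAt ℂ W p :=
        DifferentiableOn.analyticAt
          (fun z hz => (hW z hz).differentiableAt.differentiableWithinAt)
          (Metric.ball_mem_nhds p hρ)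
      have hs : HasStrictDerivAt W (w p) p := by
        have := hWa.hasStrictDerivAt
        rwa [(hW p (Metric.mem_ball_self hρ)).deriv] at this
      have h1 := hs.map_nhds_eq (hL.w_ne hc hcw hp)
      rw [hW0] at h1
      rw [← h1]
      exact Filter.image_mem_map (Metric.ball_mem_nhds p hρ)
    set r := u13 p / w p with hr
    have hcont : Continuous fun B : M3 => ((F p)ᴴ * B * F p) 0 2 / r := by
      refine Continuous.div_const ?_ r
      exact ((continuous_const.mul continuous_id).mul continuous_const).matrix_elem 0 2
    -- The functional reads off the coefficient of A₀ in the conjugated logarithm, as in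
    -- `eq_of_commute_cyclic`. The neighbourhood consists of the B for which this coefficient is a
    -- value of W.
    have hN : (fun B : M3 => ((F p)ᴴ * B * F p) 0 2 / r) ⁻¹' (W '' Metric.ball p ρ) ∈
        𝓝 (0 : M3) := by
      refine hcont.continuousAt.preimage_mem_nhds ?_
      simpa using hopen
    have hlog := exists_skew_log _ hN
    have hcoe : Filter.Tendsto
        (fun g : suCentralizer M => ((g : Matrix.specialUnitaryGroup (Fin 3) ℂ) : M3))
        (𝓝 1) (𝓝 1) :=
      (continuous_subtype_val.comp continuous_subtype_val).tendsto (1 : suCentralizer M)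
    filter_upwards [hcoe.eventually hlog] with g hg
    obtain ⟨B, ⟨z, hz, hWz⟩, hBs, hBe, hBc⟩ :=
      hg (Matrix.mem_specialUnitaryGroup_iff.1 (g : Matrix.specialUnitaryGroup (Fin 3) ℂ).2).1
    have hBM : B * M = M * B := hBc M g.2
    set A := (w p)⁻¹ • formA w u12 u21 u13 p with hA
    set X := (F p)ᴴ * B * F p with hX
    have hXA : X * A = A * X := by
      have e1 : F p * A = M * F p := (hMF p hp).symm
      have e2 : A * (F p)ᴴ = (F p)ᴴ * M := by
        rw [← hM p hp, ← mul_assoc, ← mul_assoc, hFF p hp, one_mul]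
      calc X * A = (F p)ᴴ * B * (F p * A) := by rw [hX, mul_assoc]
        _ = (F p)ᴴ * (B * M) * F p := by rw [e1]; simp only [mul_assoc]
        _ = A * (F p)ᴴ * B * F p := by rw [hBM, e2]; simp only [mul_assoc]
        _ = A * X := by rw [hX]; simp only [mul_assoc]
    have hXs : Xᴴ = -X := by
      rw [hX, Matrix.conjTranspose_mul, Matrix.conjTranspose_mul, hBs,
        Matrix.conjTranspose_conjTranspose]
      simp only [mul_assoc, neg_mul, mul_neg]
    -- This is the entry (1,0) of A₀, whose nonvanishing makes e₃ cyclic.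
    have hKne : K / r ^ 2 ≠ 0 := by
      have h1 := hL.u21_ne hc hcw hp
      have h2 := h.u13_ne p hp
      refine div_ne_zero ?_ (pow_ne_zero 2 (hr0 p hp))
      rintro rfl
      have h3 := hK p hp
      rw [zero_mul] at h3
      exact mul_ne_zero h1 (pow_ne_zero 2 h2) h3
    obtain ⟨τ, hτ⟩ := eq_of_commute_cyclic (hr0 p hp) hKne
      (hL.formA_eq hc hcw hp (hK p hp)) (hL.normal_formA hc hcw hp) hXA hXs
    rw [← hA] at hτ
    change W z = X 0 2 / r at hWz
    rw [← hr, ← hWz] at hτ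
    have hBX : B = F p * X * (F p)ᴴ := by
      calc B = (F p * (F p)ᴴ) * B * (F p * (F p)ᴴ) := by rw [hFF' p hp, one_mul, mul_one]
        _ = _ := by rw [hX]; simp only [mul_assoc]
    have hBeq : B = (W z • M - star (W z) • Mᴴ) + ((τ : ℂ) * I) • (1 : M3) := by
      rw [hBX, hτ]
      have e1 : F p * A * (F p)ᴴ = M := hM p hp
      have e2 : F p * Aᴴ * (F p)ᴴ = Mᴴ := by
        rw [← e1, Matrix.conjTranspose_mul, Matrix.conjTranspose_mul,
          Matrix.conjTranspose_conjTranspose, mul_assoc]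
      simp only [mul_add, mul_sub, add_mul, sub_mul, mul_smul_comm, smul_mul_assoc, e1, e2,
        mul_one, hFF' p hp]
    -- Up to a phase, invisible in ℂP², g is the flow exp(W(z)M - W̄(z)M*), which takes φ(p) to
    -- φ(z).
    have hgexp : ((g : Matrix.specialUnitaryGroup (Fin 3) ℂ) : M3) =
        Complex.exp ((τ : ℂ) * I) • NormedSpace.exp (W z • M - star (W z) • Mᴴ) := by
      have hcm : Commute (W z • M - star (W z) • Mᴴ) (((τ : ℂ) * I) • (1 : M3)) :=
        (Commute.one_right _).smul_right _
      have hone : NormedSpace.exp (((τ : ℂ) * I) • (1 : M3)) =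
          Complex.exp ((τ : ℂ) * I) • (1 : M3) := by
        rw [← Matrix.diagonal_one, ← Matrix.diagonal_smul, Matrix.exp_diagonal,
          ← Matrix.diagonal_smul]
        congr 1
        funext i
        rw [Pi.coe_exp, Complex.exp_eq_exp_ℂ]
        simp
      rw [← hBe, hBeq, Matrix.exp_add_of_commute _ _ hcm, hone, mul_smul_comm, mul_one]
    refine ⟨z, hball hz, ?_⟩
    rw [hfm p hp, hfm z (hball hz)]
    refine (act_mk _ _ (a := Complex.exp ((τ : ℂ) * I)) ?_).symm
    rw [hgexp, hflow z hz, Matrix.smul_mulVec]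

end IsSpecialFrame

namespace IsSpecialFrame

variable {D : Set ℂ} {F : ℂ → M3} {u11 w u12 u13 u21 u32 : ℂ → ℂ}

/-- In the branch u₁₃ = u₃₂ the constant c = 3|w|²/|u₁₃|² decides: c = 0 forces w = 0 and then u₁₂ =
0, hence minimality, while c ≠ 0 is the flat homogeneous case. -/
theorem of_sigma_cube (h : IsSpecialFrame D F u11 w u12 u13 u21 u32) (hDc : IsPreconnected D)
    {f : ℂ → CP2} (hf : IsLift D (lastCol F) f)
    (hp : IsPrimitiveHarmonic D (sigma^[3]) 2 F) :
    (IsMinimal D f ∧ IsLagrangian D f) ∨ (IsFlat D f ∧ IsHomogeneous D f) := by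
  have hint := h.formIntegrable_of_isPrimitiveHarmonic hp
  rcases h.sigma_cube_dichotomy hDc hp with he | he
  · have eqs := h.sigma_cube_lagrangian_equations hp he
    have hL : LagrangianSystem D u11 w u12 u21 u13 :=
      { isOpen := h.isOpen
        conn := hDc
        smooth_u11 := h.smooth_u11
        smooth_w := h.smooth_w
        smooth_u12 := h.smooth_u12
        smooth_u21 := h.smooth_u21
        smooth_q := h.smooth_u13
        q_ne := h.u13_ne
        dzbar_w := fun z hz => (eqs z hz).1
        dzbar_u12 := fun z hz => (eqs z hz).2.1
        dzbar_u21 := fun z hz => (eqs z hz).2.2.1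
        dzbar_q := fun z hz => (eqs z hz).2.2.2.1
        u12_q := fun z hz => (eqs z hz).2.2.2.2.1
        gauss := fun z hz => (eqs z hz).2.2.2.2.2 }
    have hlag : IsLagrangian D f := h.isLagrangian hf fun z hz => by rw [he z hz]
    obtain ⟨c, hcw⟩ := hL.exists_const_u12
    by_cases hc : c = 0
    · refine Or.inl ⟨h.isMinimal hint (fun z hz => ?_) hf, hlag⟩
      have h1 := (hcw z hz).2
      rw [hc, zero_mul, eq_comm] at h1
      have hw : w z = 0 := by
        by_contra hw
        exact mul_ne_zero three_ne_zero (mul_ne_zero hw (star_ne_zero.2 hw)) h1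
      have h2 := hL.u12_q z hz
      rw [hw, star_zero, mul_zero, zero_mul] at h2
      exact (mul_eq_zero.1 h2).resolve_right (hL.star_q_ne hz)
    · exact Or.inr ⟨h.isFlat hL he hc hcw hf, h.isHomogeneous hL he hc hcw hf⟩
  · exact Or.inl ⟨h.isMinimal hint (fun z hz => (he z hz).2) hf,
      h.isLagrangian hf fun z hz => by rw [(he z hz).1, norm_neg]⟩

end IsSpecialFrame

end CP2Surf

theorem theorem2 (D : Set ℂ) (hDo : IsOpen D) (hDs : IsSimplyConnected D)
    (F : ℂ → Matrix (Fin 3) (Fin 3) ℂ)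
    (hFs : ∀ i j, ContDiffOn ℝ ∞ (fun z => F z i j) D)
    (hFu : ∀ z ∈ D, F z ∈ Matrix.specialUnitaryGroup (Fin 3) ℂ)
    (u11 w u12 u13 u21 u32 : ℂ → ℂ)
    (hU : ∀ z ∈ D, (F z)⁻¹ * matDz F z =
      !![u11 z + w z, u12 z, u13 z;
         u21 z, -u11 z + w z, 0;
         0, u32 z, -2 * w z])
    (hV : ∀ z ∈ D, (F z)⁻¹ * matDzbar F z =
      !![-star (u11 z) - star (w z), -star (u21 z), 0;
         -star (u12 z), star (u11 z) - star (w z), -star (u32 z);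
         -star (u13 z), 0, 2 * star (w z)])
    (h13 : ∀ z ∈ D, u13 z ≠ 0) (h32 : ∀ z ∈ D, u32 z ≠ 0) :
    ∃ f : ℂ → CP2,
      IsDerivedFrom D F f ∧
      (IsPrimitiveHarmonic D sigma 6 F → IsMinimal D f ∧ IsLagrangian D f) ∧
      (IsPrimitiveHarmonic D (sigma^[2]) 3 F → IsMinimal D f) ∧
      (IsPrimitiveHarmonic D (sigma^[3]) 2 F →
        (IsMinimal D f ∧ IsLagrangian D f) ∨ (IsFlat D f ∧ IsHomogeneous D f)) := by
  have h : IsSpecialFrame D F u11 w u12 u13 u21 u32 := ⟨hDo, hFs, hFu, hU, hV, h13, h32⟩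
  classical
  -- Outside D nothing prevents F e₃ from vanishing; an arbitrary point serves as the value there.
  let f : ℂ → CP2 := fun z =>
    if h0 : lastCol F z ≠ 0 then Projectivization.mk ℂ (lastCol F z) h0
    else Projectivization.mk ℂ ![0, 0, 1] (fun h1 => by simpa using congrFun h1 2)
  have hf : IsLift D (lastCol F) f := by
    refine ⟨h.smooth_lastCol, fun z hz => ⟨(h.adaptedAt hz).unit, h.lastCol_ne_zero hz, ?_⟩⟩
    exact dif_pos (h.lastCol_ne_zero hz)
  refine ⟨f, h.isDerivedFrom hDs hf, fun hp => ?_, fun hp => ?_, fun hp => ?_⟩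
  · have hs := h.of_sigma hp
    exact ⟨h.isMinimal (h.formIntegrable_of_isPrimitiveHarmonic hp) (fun z hz => (hs z hz).1) hf,
      h.isLagrangian hf fun z hz => by rw [(hs z hz).2]⟩
  · exact h.isMinimal (h.formIntegrable_of_isPrimitiveHarmonic hp)
      (h.u12_eq_zero_of_sigma_sq hp) hf
  · exact h.of_sigma_cube hDs.isPathConnected.isConnected.isPreconnected hf hp
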